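/- Let $\mathbb R^4$ carry Cartesian coordinates $(t,x,y,z)=(\underline x,z)$ and let $P=-\partial_t^2+\partial_x^2+\partial_y^2+\partial_z^2$. All functions take values in $\mathbb K$, where $\mathbb K$ is $\mathbb R$ or $\mathbb C$, and all spaces and maps are $\mathbb K$-linear. For $A\subseteq\mathbb R^4$ let $J^\pm(A)$ be the causal future ($+$) and past ($-$) of $A$ in Minkowski spacetime. A closed set $A$ is timelike compact if $A\cap J^+(K)$ and $A\cap J^-(K)$ are compact for every compact $K$; $C^\infty_{tc}(\mathbb R^4)$ is the space of smooth functions with timelike compact support. Put $$C^\infty_{tc,-}(\mathbb R^4)=\{\alpha\in C^\infty_{tc}(\mathbb R^4)\mid \alpha(\underline x,z)=-\alpha(\underline x,-z)\},$$ and, for $d>0$, $$C^\infty_{tc,Z}(\mathbb R^4)=\{\alpha\in C^\infty_{tc,-}(\mathbb R^4)\mid \alpha(\underline x,z)=-\alpha(\underline x,2d-z)\}.$$ For $A$ one of these spaces (each is mapped into itself by $P$), write $A(\,\cdot\,;P)$ for the quotient $A/P[A]$. Let $\mathbb H^4=\{z\ge 0\}$ and $Z=\{0\le z\le d\}$. For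 $\Omega=\mathbb H^4$ or $\Omega=Z$ let $\mathcal S^D(\Omega)$ be the space of functions $\varphi$ on $\Omega$ that are smooth up to the boundary and satisfy $P\varphi=0$ on $\Omega$ and $\varphi|_{\partial\Omega}=0$. Then the following hold. 1. There are unique linear operators $E^\pm:C^\infty_{tc}(\mathbb R^4)\to C^\infty(\mathbb R^4)$ with $P E^\pm\alpha=E^\pm P\alpha=\alpha$ and $\operatorname{supp}(E^\pm\alpha)\subseteq J^\mp(\operatorname{supp}\alpha)$ for all $\alpha\in C^\infty_{tc}(\mathbb R^4)$. Let $E=E^+-E^-$ be the causal propagator. 2. Every $\varphi\in\mathcal S^D(\mathbb H^4)$ is the restriction of a unique $\psi\in C^\infty(\mathbb R^4)$ with $P\psi=0$ that is odd under $z\mapsto -z$. For every $d>0$, every $\varphi\in\mathcal S^D(Z)$ is the restriction of a unique $\psi\in C^\infty(\mathbb R^4)$ with $P\psi=0$ that is odd under $z\mapsto-z$ and under $z\mapsto 2d-z$. 3. The assignment $[\alpha]\mapsto (E\alpha)|_{\mathbb H^4}$ is a well-defined linear isomorphism $$C^\infty_{tc,-}(\mathbb R^4;P)=\frac{C^\infty_{tc,-}(\mathbb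 R^4)}{P[C^\infty_{tc,-}(\mathbb R^4)]}\;\xrightarrow{\ \simeq\ }\;\mathcal S^D(\mathbb H^4),$$ and, for every $d>0$, the assignment $[\alpha]\mapsto (E\alpha)|_{Z}$ is a well-defined linear isomorphism $$C^\infty_{tc,Z}(\mathbb R^4;P)=\frac{C^\infty_{tc,Z}(\mathbb R^4)}{P[C^\infty_{tc,Z}(\mathbb R^4)]}\;\xrightarrow{\ \simeq\ }\;\mathcal S^D(Z).$$ -/

import Mathlib

open scoped ContDiff

namespace DirichletWave

noncomputable section

/-- Minkowski spacetime `ℝ⁴ = ℝ × ℝ³` with coordinates `p = (t, (x, y, z))`. -/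
abbrev Spacetime : Type := ℝ × EuclideanSpace ℝ (Fin 3)

/-- The coordinate `z` (the last spatial coordinate). -/
def zCoord (p : Spacetime) : ℝ := p.2 2

/-- The coordinate vector of `t`. -/
def timeDir : Spacetime := (1, 0)

/-- The coordinate vectors of `x, y, z`. -/
def spaceDir (i : Fin 3) : Spacetime := (0, EuclideanSpace.single i 1)

/-- The reflection `(t, x, y, z) ↦ (t, x, y, 2c - z)`. -/
def reflect (c : ℝ) (p : Spacetime) : Spacetime :=
  (p.1, !₂[p.2 0, p.2 1, 2 * c - p.2 2])

/-- The causal future `J⁺(A)`. -/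
def causalFuture (A : Set Spacetime) : Set Spacetime :=
  {q | ∃ p ∈ A, ‖q.2 - p.2‖ ≤ q.1 - p.1}

/-- The causal past `J⁻(A)`. -/
def causalPast (A : Set Spacetime) : Set Spacetime :=
  {q | ∃ p ∈ A, ‖q.2 - p.2‖ ≤ p.1 - q.1}

/-- A closed set is timelike compact if its intersection with the causal future and with the causal
past of every compact set is compact. -/
def IsTimelikeCompact (A : Set Spacetime) : Prop :=
  IsClosed A ∧ ∀ K : Set Spacetime, IsCompact K →
    IsCompact (A ∩ causalFuture K) ∧ IsCompact (A ∩ causalPast K)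

theorem IsTimelikeCompact.mono {A B : Set Spacetime} (hB : IsTimelikeCompact B)
    (hA : IsClosed A) (h : A ⊆ B) : IsTimelikeCompact A := by
  refine ⟨hA, fun K hK => ⟨?_, ?_⟩⟩
  · have := (hB.2 K hK).1.inter_left hA
    rwa [← Set.inter_assoc, Set.inter_eq_left.2 h] at this
  · have := (hB.2 K hK).2.inter_left hA
    rwa [← Set.inter_assoc, Set.inter_eq_left.2 h] at this

theorem IsTimelikeCompact.union {A B : Set Spacetime} (hA : IsTimelikeCompact A)
    (hB : IsTimelikeCompact B) : IsTimelikeCompact (A ∪ B) := by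
  refine ⟨hA.1.union hB.1, fun K hK => ⟨?_, ?_⟩⟩
  · rw [Set.union_inter_distrib_right]
    exact (hA.2 K hK).1.union (hB.2 K hK).1
  · rw [Set.union_inter_distrib_right]
    exact (hA.2 K hK).2.union (hB.2 K hK).2

/-- The half-space `ℍ⁴ = {z ≥ 0}`. -/
def halfSpace : Set Spacetime := {p | 0 ≤ zCoord p}

/-- The slab `Z = {0 ≤ z ≤ d}`. -/
def slab (d : ℝ) : Set Spacetime := {p | 0 ≤ zCoord p ∧ zCoord p ≤ d}

/-- The quotient `A / P[A]` for a `P`-invariant subspace `A`. -/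
abbrev QuotByImage {R V : Type*} [Ring R] [AddCommGroup V] [Module R V] (P : V →ₗ[R] V)
    (A : Submodule R V) : Type _ :=
  A ⧸ (A.map P).submoduleOf A

variable (𝕜 : Type*) [RCLike 𝕜]

/-- `C^∞(ℝ⁴)`, with values in `𝕜 = ℝ` or `ℂ`. -/
def smooth : Submodule 𝕜 (Spacetime → 𝕜) where
  carrier := {f | ContDiff ℝ ∞ f}
  add_mem' {f g} hf hg := by
    have hf' : ContDiff ℝ ∞ f := hf
    have hg' : ContDiff ℝ ∞ g := hg
    exact hf'.add hg'
  zero_mem' := by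
    have h : ContDiff ℝ ∞ (fun _ : Spacetime => (0 : 𝕜)) := contDiff_const
    exact h
  smul_mem' c f hf := by
    have hf' : ContDiff ℝ ∞ f := hf
    have h : ContDiff ℝ ∞ (fun p => c * f p) := contDiff_const.mul hf'
    exact h

variable {𝕜}

theorem contDiff_smooth (f : smooth 𝕜) : ContDiff ℝ ∞ (f : Spacetime → 𝕜) := f.2

theorem smooth_differentiable (f : smooth 𝕜) : Differentiable ℝ (f : Spacetime → 𝕜) :=
  (contDiff_smooth f).differentiable (by simp)

/-- The derivative in the direction `v`, as an operator on `C^∞(ℝ⁴)`. -/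
def dirDeriv (v : Spacetime) : smooth 𝕜 →ₗ[𝕜] smooth 𝕜 where
  toFun f := ⟨fun p => fderiv ℝ (f : Spacetime → 𝕜) p v,
    ((contDiff_smooth f).fderiv_right (m := ∞) (by simp)).clm_apply contDiff_const⟩
  map_add' f g := by
    ext p
    exact congrArg (fun L : Spacetime →L[ℝ] 𝕜 => L v)
      (fderiv_add (smooth_differentiable f p) (smooth_differentiable g p))
  map_smul' c f := by
    ext p
    exact congrArg (fun L : Spacetime →L[ℝ] 𝕜 => L v)
      (fderiv_const_smul (smooth_differentiable f p) c)

/-- The wave operator `P = -∂ₜ² + ∂ₓ² + ∂_y² + ∂_z²` on `C^∞(ℝ⁴)`. -/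
def waveOp : smooth 𝕜 →ₗ[𝕜] smooth 𝕜 :=
  -(dirDeriv timeDir ∘ₗ dirDeriv timeDir) +
    ∑ i : Fin 3, dirDeriv (spaceDir i) ∘ₗ dirDeriv (spaceDir i)

theorem dirDeriv_apply (v : Spacetime) (f : smooth 𝕜) (p : Spacetime) :
    (dirDeriv v f : Spacetime → 𝕜) p = fderiv ℝ (f : Spacetime → 𝕜) p v := rfl

theorem waveOp_apply (f : smooth 𝕜) (p : Spacetime) :
    (waveOp f : Spacetime → 𝕜) p =
      -(dirDeriv timeDir (dirDeriv timeDir f) : Spacetime → 𝕜) p +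
      ∑ i : Fin 3, (dirDeriv (spaceDir i) (dirDeriv (spaceDir i) f) : Spacetime → 𝕜) p := by
  simp [waveOp, Finset.sum_apply]

theorem tsupport_dirDeriv_subset (v : Spacetime) (f : smooth 𝕜) :
    tsupport (dirDeriv v f : Spacetime → 𝕜) ⊆ tsupport (f : Spacetime → 𝕜) :=
  tsupport_fderiv_apply_subset ℝ (f := (f : Spacetime → 𝕜)) v

theorem tsupport_waveOp_subset (f : smooth 𝕜) :
    tsupport (waveOp f : Spacetime → 𝕜) ⊆ tsupport (f : Spacetime → 𝕜) := by
  refine closure_minimal (fun p hp => ?_) (isClosed_tsupport _)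
  by_contra h
  have key : ∀ v : Spacetime, (dirDeriv v (dirDeriv v f) : Spacetime → 𝕜) p = 0 := fun v =>
    image_eq_zero_of_notMem_tsupport
      (fun h' => h (tsupport_dirDeriv_subset v f (tsupport_dirDeriv_subset v _ h')))
  exact hp (by rw [waveOp_apply]; simp [key])

variable (𝕜) in
/-- `C^∞_tc(ℝ⁴)`: the smooth functions with timelike compact support. -/
def smoothTC : Submodule 𝕜 (smooth 𝕜) where
  carrier := {f | IsTimelikeCompact (tsupport (f : Spacetime → 𝕜))}
  add_mem' hf hg := (IsTimelikeCompact.union hf hg).mono (isClosed_tsupport _) (tsupport_add _ _)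
  zero_mem' := by
    have : tsupport ((0 : smooth 𝕜) : Spacetime → 𝕜) = ∅ := tsupport_eq_empty_iff.2 rfl
    have h : IsTimelikeCompact (tsupport ((0 : smooth 𝕜) : Spacetime → 𝕜)) := by
      rw [this]
      simp [IsTimelikeCompact]
    exact h
  smul_mem' c f hf := IsTimelikeCompact.mono hf (isClosed_tsupport _)
    (closure_mono (Function.support_const_smul_subset c (f : Spacetime → 𝕜)))

/-- The wave operator as an operator on `C^∞_tc(ℝ⁴)`. -/
def waveOpTC : smoothTC 𝕜 →ₗ[𝕜] smoothTC 𝕜 :=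
  waveOp.restrict fun f hf =>
    IsTimelikeCompact.mono hf (isClosed_tsupport _) (tsupport_waveOp_subset f)

variable (𝕜) in
/-- The smooth functions that are odd under the reflection `z ↦ 2c - z`. -/
def oddAbout (c : ℝ) : Submodule 𝕜 (smooth 𝕜) where
  carrier := {f | ∀ p, (f : Spacetime → 𝕜) p = -(f : Spacetime → 𝕜) (reflect c p)}
  add_mem' {f g} hf hg p := by
    change (f : Spacetime → 𝕜) p + (g : Spacetime → 𝕜) p = -(_ + _)
    rw [hf p, hg p, neg_add]
  zero_mem' p := by simp
  smul_mem' a f hf p := by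
    change a * (f : Spacetime → 𝕜) p = -(a * _)
    rw [hf p, mul_neg]

variable (𝕜) in
/-- `C^∞_{tc,-}(ℝ⁴)`: the functions in `C^∞_tc(ℝ⁴)` that are odd under `z ↦ -z`. -/
def smoothTCOdd : Submodule 𝕜 (smooth 𝕜) := smoothTC 𝕜 ⊓ oddAbout 𝕜 0

variable (𝕜) in
/-- `C^∞_{tc,Z}(ℝ⁴)`: the functions in `C^∞_{tc,-}(ℝ⁴)` that are also odd under `z ↦ 2d - z`. -/
def smoothTCSlab (d : ℝ) : Submodule 𝕜 (smooth 𝕜) := smoothTCOdd 𝕜 ⊓ oddAbout 𝕜 d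

theorem smoothTCOdd_le : smoothTCOdd 𝕜 ≤ smoothTC 𝕜 := inf_le_left

theorem smoothTCSlab_le (d : ℝ) : smoothTCSlab 𝕜 d ≤ smoothTC 𝕜 := inf_le_left.trans inf_le_left

theorem dirDeriv_of_reflect {c ε δ : ℝ} {v : Spacetime}
    (hv : ∀ (p : Spacetime) (s : ℝ), reflect c (p + s • v) = reflect c p + (ε * s) • v)
    {f : smooth 𝕜}
    (hf : ∀ p, (f : Spacetime → 𝕜) p = (δ : 𝕜) * (f : Spacetime → 𝕜) (reflect c p))
    (p : Spacetime) :
    (dirDeriv v f : Spacetime → 𝕜) p =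
      ((δ * ε : ℝ) : 𝕜) * (dirDeriv v f : Spacetime → 𝕜) (reflect c p) := by
  have h1 : HasDerivAt (fun s : ℝ => (f : Spacetime → 𝕜) (p + s • v))
      ((dirDeriv v f : Spacetime → 𝕜) p) 0 := by
    rw [dirDeriv_apply]
    have := (smooth_differentiable f p).hasFDerivAt.hasLineDerivAt v
    unfold HasLineDerivAt at this
    exact this
  have h2 : HasDerivAt (fun s : ℝ => (f : Spacetime → 𝕜) (reflect c p + s • v))
      ((dirDeriv v f : Spacetime → 𝕜) (reflect c p)) (ε * 0) := by
    rw [mul_zero]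
    rw [dirDeriv_apply]
    have := (smooth_differentiable f (reflect c p)).hasFDerivAt.hasLineDerivAt v
    unfold HasLineDerivAt at this
    exact this
  have h3 := (h2.scomp (0 : ℝ) ((hasDerivAt_id (0 : ℝ)).const_mul ε)).const_mul (δ : 𝕜)
  have h4 : (fun s : ℝ => (f : Spacetime → 𝕜) (p + s • v)) =
      fun s : ℝ => (δ : 𝕜) * ((fun s : ℝ => (f : Spacetime → 𝕜) (reflect c p + s • v)) ∘
        fun s => ε * s) s := by
    funext s
    rw [hf, hv]
    rfl
  rw [h4] at h1
  rw [h1.unique h3, mul_one, RCLike.real_smul_eq_coe_mul, ← mul_assoc]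
  push_cast
  rfl

theorem waveOp_mem_oddAbout {c : ℝ} {f : smooth 𝕜} (hf : f ∈ oddAbout 𝕜 c) :
    waveOp f ∈ oddAbout 𝕜 c := by
  have key : ∀ (v : Spacetime) (ε : ℝ), ε * ε = 1 →
      (∀ (p : Spacetime) (s : ℝ), reflect c (p + s • v) = reflect c p + (ε * s) • v) →
      ∀ p, (dirDeriv v (dirDeriv v f) : Spacetime → 𝕜) p =
        -(dirDeriv v (dirDeriv v f) : Spacetime → 𝕜) (reflect c p) := by
    intro v ε hε hv p
    have h0 : ∀ p, (f : Spacetime → 𝕜) p =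
        ((-1 : ℝ) : 𝕜) * (f : Spacetime → 𝕜) (reflect c p) := by
      intro p; rw [hf p]; simp
    have h1 := dirDeriv_of_reflect hv h0
    have h2 := dirDeriv_of_reflect hv h1 p
    rw [h2, mul_assoc, hε]
    simp
  intro p
  rw [waveOp_apply, waveOp_apply, key timeDir 1 (by norm_num) ?_ p,
    Finset.sum_congr rfl fun i _ => key (spaceDir i) (if i = 2 then -1 else 1)
      (by split_ifs <;> norm_num) ?_ p]
  · rw [Finset.sum_neg_distrib, neg_add]
  · intro p s
    refine Prod.ext ?_ ?_
    · split_ifs <;> simp [reflect, spaceDir]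
    · ext j
      fin_cases i <;> fin_cases j <;> simp [reflect, spaceDir] <;> ring
  · intro p s
    refine Prod.ext ?_ ?_
    · simp [reflect, timeDir]
    · ext j
      fin_cases j <;> simp [reflect, timeDir]

theorem map_waveOp_smoothTCOdd_le : (smoothTCOdd 𝕜).map waveOp ≤ smoothTCOdd 𝕜 := by
  rintro _ ⟨f, hf, rfl⟩
  exact ⟨(waveOpTC ⟨f, hf.1⟩).2, waveOp_mem_oddAbout hf.2⟩

theorem map_waveOp_smoothTCSlab_le (d : ℝ) :
    (smoothTCSlab 𝕜 d).map waveOp ≤ smoothTCSlab 𝕜 d := by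
  rintro _ ⟨f, hf, rfl⟩
  exact ⟨map_waveOp_smoothTCOdd_le ⟨f, hf.1, rfl⟩, waveOp_mem_oddAbout hf.2⟩

/-- `E` is an advanced fundamental solution: `P ∘ E = E ∘ P = id` on `C^∞_tc(ℝ⁴)` and
`supp (E α) ⊆ J⁻(supp α)`. -/
structure IsAdvanced (E : smoothTC 𝕜 →ₗ[𝕜] smooth 𝕜) : Prop where
  wave_apply : ∀ α : smoothTC 𝕜, waveOp (E α) = α
  apply_wave : ∀ α : smoothTC 𝕜, E (waveOpTC α) = α
  supp : ∀ α : smoothTC 𝕜, tsupport (E α : Spacetime → 𝕜) ⊆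
    causalPast (tsupport ((α : smooth 𝕜) : Spacetime → 𝕜))

/-- `E` is a retarded fundamental solution: `P ∘ E = E ∘ P = id` on `C^∞_tc(ℝ⁴)` and
`supp (E α) ⊆ J⁺(supp α)`. -/
structure IsRetarded (E : smoothTC 𝕜 →ₗ[𝕜] smooth 𝕜) : Prop where
  wave_apply : ∀ α : smoothTC 𝕜, waveOp (E α) = α
  apply_wave : ∀ α : smoothTC 𝕜, E (waveOpTC α) = α
  supp : ∀ α : smoothTC 𝕜, tsupport (E α : Spacetime → 𝕜) ⊆
    causalFuture (tsupport ((α : smooth 𝕜) : Spacetime → 𝕜))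

/-- The derivative within `Ω` in the direction `v` (one-sided at boundary points of `Ω`). -/
def dirDerivWithin (Ω : Set Spacetime) (v : Spacetime) (φ : Spacetime → 𝕜) : Spacetime → 𝕜 :=
  fun p => fderivWithin ℝ φ Ω p v

/-- The wave operator `-∂ₜ² + ∂ₓ² + ∂_y² + ∂_z²` on `Ω`. -/
def waveOpWithin (Ω : Set Spacetime) (φ : Spacetime → 𝕜) (p : Spacetime) : 𝕜 :=
  -dirDerivWithin Ω timeDir (dirDerivWithin Ω timeDir φ) p +
    ∑ i : Fin 3, dirDerivWithin Ω (spaceDir i) (dirDerivWithin Ω (spaceDir i) φ) p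

/-- A function on `Ω`, continued by zero. Smoothness on `Ω` and derivatives within `Ω` depend only
on the values on `Ω`. -/
def zeroExtend {Ω : Set Spacetime} (φ : Ω → 𝕜) : Spacetime → 𝕜 :=
  Function.extend Subtype.val φ 0

theorem zeroExtend_add {Ω : Set Spacetime} (φ ψ : Ω → 𝕜) :
    zeroExtend (φ + ψ) = zeroExtend φ + zeroExtend ψ := by
  simpa [zeroExtend] using Function.extend_add (Subtype.val : Ω → Spacetime) φ ψ 0 0

theorem zeroExtend_smul {Ω : Set Spacetime} (c : 𝕜) (φ : Ω → 𝕜) :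
    zeroExtend (c • φ) = c • zeroExtend φ := by
  simpa [zeroExtend] using Function.extend_smul c (Subtype.val : Ω → Spacetime) φ 0

/-- `φ : Ω → 𝕜` is a smooth Dirichlet solution: smooth up to the boundary, `P φ = 0` on `Ω` and
`φ = 0` on `∂Ω`. -/
structure IsDirichletSolution (Ω : Set Spacetime) (φ : Ω → 𝕜) : Prop where
  contDiffOn : ContDiffOn ℝ ∞ (zeroExtend φ) Ω
  wave : ∀ p ∈ Ω, waveOpWithin Ω (zeroExtend φ) p = 0
  boundary : ∀ p : Ω, (p : Spacetime) ∈ frontier Ω → φ p = 0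

theorem dirDerivWithin_contDiffOn {Ω : Set Spacetime} (hΩ : UniqueDiffOn ℝ Ω) (v : Spacetime)
    {φ : Spacetime → 𝕜} (hφ : ContDiffOn ℝ ∞ φ Ω) : ContDiffOn ℝ ∞ (dirDerivWithin Ω v φ) Ω :=
  (hφ.fderivWithin (m := ∞) hΩ (by simp)).clm_apply contDiffOn_const

theorem dirDerivWithin_comb {Ω : Set Spacetime} (hΩ : UniqueDiffOn ℝ Ω) (v : Spacetime)
    (c : 𝕜) {φ ψ : Spacetime → 𝕜} (hφ : ContDiffOn ℝ ∞ φ Ω) (hψ : ContDiffOn ℝ ∞ ψ Ω)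
    {p : Spacetime} (hp : p ∈ Ω) :
    dirDerivWithin Ω v (fun q => c * φ q + ψ q) p =
      c * dirDerivWithin Ω v φ p + dirDerivWithin Ω v ψ p := by
  have h1 := (hφ.differentiableOn (by simp) p hp).hasFDerivWithinAt
  have h2 := (hψ.differentiableOn (by simp) p hp).hasFDerivWithinAt
  have h3 := ((h1.const_mul c).add h2).fderivWithin (hΩ p hp)
  exact congrArg (fun L : Spacetime →L[ℝ] 𝕜 => L v) h3

theorem waveOpWithin_comb {Ω : Set Spacetime} (hΩ : UniqueDiffOn ℝ Ω)
    (c : 𝕜) {φ ψ : Spacetime → 𝕜} (hφ : ContDiffOn ℝ ∞ φ Ω) (hψ : ContDiffOn ℝ ∞ ψ Ω)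
    {p : Spacetime} (hp : p ∈ Ω) :
    waveOpWithin Ω (fun q => c * φ q + ψ q) p =
      c * waveOpWithin Ω φ p + waveOpWithin Ω ψ p := by
  have key : ∀ v, dirDerivWithin Ω v (dirDerivWithin Ω v (fun q => c * φ q + ψ q)) p =
      c * dirDerivWithin Ω v (dirDerivWithin Ω v φ) p +
        dirDerivWithin Ω v (dirDerivWithin Ω v ψ) p := by
    intro v
    rw [← dirDerivWithin_comb hΩ v c (dirDerivWithin_contDiffOn hΩ v hφ)
      (dirDerivWithin_contDiffOn hΩ v hψ) hp]
    have h := fderivWithin_congr (𝕜 := ℝ) (x := p)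
      (fun q hq => dirDerivWithin_comb hΩ v c hφ hψ hq)
      (dirDerivWithin_comb hΩ v c hφ hψ hp)
    exact congrArg (fun L : Spacetime →L[ℝ] 𝕜 => L v) h
  simp only [waveOpWithin, key, Finset.sum_add_distrib, ← Finset.mul_sum]
  ring

variable (𝕜) in
/-- `S^D(Ω)`: the space of smooth Dirichlet solutions on `Ω`. -/
def dirichletSolutions (Ω : Set Spacetime) (hΩ : UniqueDiffOn ℝ Ω) : Submodule 𝕜 (Ω → 𝕜) where
  carrier := {φ | IsDirichletSolution Ω φ}
  add_mem' {φ ψ} hφ hψ := by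
    have hφ' : IsDirichletSolution Ω φ := hφ
    have hψ' : IsDirichletSolution Ω ψ := hψ
    have e : zeroExtend (φ + ψ) = fun q => (1 : 𝕜) * zeroExtend φ q + zeroExtend ψ q := by
      rw [zeroExtend_add]; funext q; simp
    have h : IsDirichletSolution Ω (φ + ψ) := by
      refine ⟨?_, fun p hp => ?_, fun p hp => ?_⟩
      · rw [zeroExtend_add]
        exact hφ'.contDiffOn.add hψ'.contDiffOn
      · rw [e, waveOpWithin_comb hΩ 1 hφ'.contDiffOn hψ'.contDiffOn hp, hφ'.wave p hp,
          hψ'.wave p hp]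
        simp
      · simp [hφ'.boundary p hp, hψ'.boundary p hp]
    exact h
  zero_mem' := by
    have e : zeroExtend (0 : Ω → 𝕜) = fun _ => 0 := by
      have := zeroExtend_smul (0 : 𝕜) (0 : Ω → 𝕜)
      rw [zero_smul, zero_smul] at this
      exact this
    have h : IsDirichletSolution Ω (0 : Ω → 𝕜) := by
      refine ⟨?_, fun p hp => ?_, fun p hp => rfl⟩
      · rw [e]
        exact contDiffOn_const
      · have := waveOpWithin_comb hΩ (0 : 𝕜) (φ := fun _ => 0) (ψ := fun _ => 0)
          contDiffOn_const contDiffOn_const hp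
        have h2 := waveOpWithin_comb hΩ (1 : 𝕜) (φ := fun _ => 0) (ψ := fun _ => 0)
          contDiffOn_const contDiffOn_const hp
        simp only [mul_zero, add_zero, one_mul] at h2
        rw [e]
        simpa using h2
    exact h
  smul_mem' c φ hφ := by
    have hφ' : IsDirichletSolution Ω φ := hφ
    have e : zeroExtend (c • φ) = fun q => (c - 1) * zeroExtend φ q + zeroExtend φ q := by
      rw [zeroExtend_smul]; funext q; simp only [Pi.smul_apply, smul_eq_mul]; ring
    have h : IsDirichletSolution Ω (c • φ) := by
      refine ⟨?_, fun p hp => ?_, fun p hp => ?_⟩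
      · rw [e]
        exact (contDiffOn_const.mul hφ'.contDiffOn).add hφ'.contDiffOn
      · rw [e, waveOpWithin_comb hΩ _ hφ'.contDiffOn hφ'.contDiffOn hp, hφ'.wave p hp]
        simp
      · simp [hφ'.boundary p hp]
    exact h

theorem continuous_zCoord : Continuous zCoord := by
  unfold zCoord
  fun_prop

theorem uniqueDiffOn_halfSpace : UniqueDiffOn ℝ halfSpace := by
  refine uniqueDiffOn_convex ?_ ?_
  · intro p hp q hq a b ha hb _
    have hp' : 0 ≤ p.2 2 := hp
    have hq' : 0 ≤ q.2 2 := hq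
    have : 0 ≤ a * p.2 2 + b * q.2 2 := by positivity
    simpa [halfSpace, zCoord] using this
  · refine ⟨spaceDir 2, mem_interior.2 ⟨{p | 0 < zCoord p}, fun p hp => le_of_lt (α := ℝ) hp,
      isOpen_lt continuous_const continuous_zCoord, ?_⟩⟩
    simp [zCoord, spaceDir]

theorem uniqueDiffOn_slab {d : ℝ} (hd : 0 < d) : UniqueDiffOn ℝ (slab d) := by
  refine uniqueDiffOn_convex ?_ ?_
  · intro p hp q hq a b ha hb hab
    have hp' : 0 ≤ p.2 2 ∧ p.2 2 ≤ d := hp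
    have hq' : 0 ≤ q.2 2 ∧ q.2 2 ≤ d := hq
    obtain ⟨p1, p2⟩ := hp'
    obtain ⟨q1, q2⟩ := hq'
    have h1 : 0 ≤ a * p.2 2 + b * q.2 2 := by positivity
    have h2 : a * p.2 2 + b * q.2 2 ≤ d := by
      calc a * p.2 2 + b * q.2 2 ≤ a * d + b * d := by gcongr
        _ = d := by rw [← add_mul, hab, one_mul]
    simpa [slab, zCoord] using And.intro h1 h2
  · refine ⟨(d / 2) • spaceDir 2, mem_interior.2 ⟨{p | 0 < zCoord p ∧ zCoord p < d},
      fun p hp => ⟨le_of_lt hp.1, le_of_lt hp.2⟩,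
      (isOpen_lt continuous_const continuous_zCoord).inter
        (isOpen_lt continuous_zCoord continuous_const), ?_⟩⟩
    simp [zCoord, spaceDir, hd]

end

end DirichletWave

open DirichletWave

/-!
The advanced and retarded potentials are treated together by means of a sign `σ`, with `σ = 1` for
the future and `σ = -1` for the past. The potential of `f` is, up to a constant, the convolution of
`f` with the measure `|y|⁻¹ dy` on the light cone `{(σ|y|, y)}`. It is defined for functions whose
support is half compact, that is, compact in the past (`σ = 1`) or in the future (`σ = -1`) of every
compact set: near a point such a potential only sees a compactly supported piece of `f`, so it is
smooth and commutes with `P` (`waveOp_smoothConePotential`).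

The analytic core is Kirchhoff's formula (`conePotential_waveOp`): the potential of `P f` is a
nonzero multiple of `f`. The integrand `|y|⁻¹ (P f)(p - (σ|y|, y))` is the divergence of an explicit
vector field on `ℝ³ \ {0}`. After cutting off the singularity at scale `ε`, the divergence theorem
leaves a boundary term, which tends to a constant times `f p` as `ε → 0`. As `P` commutes with the
potential, this single identity gives both `P E = id` and `E P = id`. It also shows that a solution
of the wave equation with half compact support vanishes (`eq_of_waveOp_eq`). Since the cone over a
half compact set is half compact, the fundamental solutions are unique.

Dirichlet solutions extend by the reflection principle (`IsReflectable.contDiffOn_reflectExt`). One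
proves by induction on `n` that the odd extension of a Dirichlet solution and the even extension of
a Neumann solution are `C^n`. Tangential derivatives preserve the boundary condition. The normal
derivative exchanges the two conditions, because the wave equation expresses the second normal
derivative through tangential ones. For the slab the extension is odd and `2d`-periodic in `z`;
smoothness near each translate of a boundary plane is the half-space statement.

For the isomorphisms (`exists_causalPropagator_equiv`), uniqueness of the fundamental solutions
makes them preserve odd functions, so that `E` maps odd sources to odd solutions. If `E α` vanishes
on `Ω`, it vanishes everywhere; the common value `β` of the two potentials then has timelike compact
support, and `α = P β`. Conversely, an odd solution `ψ` is `E α` for `α = -P (χ ψ)`, where `χ` is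
a function of time equal to `0` in the past and to `1` in the future.
-/

namespace DirichletWave

open MeasureTheory Filter Topology Convolution
open scoped Pointwise

/-! ### Causal cones -/

/-- The union of the solid light cones with apex in `A`; `σ = 1` gives the causal future and
`σ = -1` the causal past. The sign is carried as a real number so that both time directions are
treated at once. -/
def cone (σ : ℝ) (A : Set Spacetime) : Set Spacetime :=
  {q | ∃ p ∈ A, ‖q.2 - p.2‖ ≤ σ * (q.1 - p.1)}

theorem cone_one (A : Set Spacetime) : cone 1 A = causalFuture A := by
  simp [cone, causalFuture]

theorem cone_neg_one (A : Set Spacetime) : cone (-1) A = causalPast A := by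
  simp [cone, causalPast]

theorem cone_mono {σ : ℝ} {A B : Set Spacetime} (h : A ⊆ B) : cone σ A ⊆ cone σ B :=
  fun _ ⟨p, hp, hpq⟩ => ⟨p, h hp, hpq⟩

theorem subset_cone (σ : ℝ) (A : Set Spacetime) : A ⊆ cone σ A :=
  fun p hp => ⟨p, hp, by simp⟩

theorem cone_cone_subset (σ : ℝ) (A : Set Spacetime) : cone σ (cone σ A) ⊆ cone σ A := by
  rintro q ⟨p, ⟨a, ha, hap⟩, hpq⟩
  refine ⟨a, ha, ?_⟩
  calc ‖q.2 - a.2‖ = ‖(q.2 - p.2) + (p.2 - a.2)‖ := by rw [sub_add_sub_cancel]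
    _ ≤ ‖q.2 - p.2‖ + ‖p.2 - a.2‖ := norm_add_le _ _
    _ ≤ σ * (q.1 - p.1) + σ * (p.1 - a.1) := add_le_add hpq hap
    _ = σ * (q.1 - a.1) := by ring

theorem isClosed_cone_of_isCompact (σ : ℝ) {A : Set Spacetime} (hA : IsCompact A) :
    IsClosed (cone σ A) := by
  have hC : IsClosed {v : Spacetime | ‖v.2‖ ≤ σ * v.1} :=
    isClosed_le (by fun_prop) (by fun_prop)
  have : cone σ A = A + {v : Spacetime | ‖v.2‖ ≤ σ * v.1} := by
    ext q
    constructor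
    · rintro ⟨p, hp, h⟩
      exact ⟨p, hp, q - p, h, add_sub_cancel p q⟩
    · rintro ⟨p, hp, v, hv, rfl⟩
      exact ⟨p, hp, by simpa using hv⟩
  rw [this]
  exact hC.add_left_of_isCompact hA

/-- Diamonds between compact sets are compact. -/
theorem isCompact_cone_inter_cone {σ : ℝ} (hσ : |σ| = 1) {A K : Set Spacetime} (hA : IsCompact A)
    (hK : IsCompact K) : IsCompact (cone σ A ∩ cone (-σ) K) := by
  obtain ⟨R, hR⟩ := (hA.union hK).isBounded.exists_norm_le
  refine Metric.isCompact_of_isClosed_isBounded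
    ((isClosed_cone_of_isCompact σ hA).inter (isClosed_cone_of_isCompact _ hK))
    ((isBounded_iff_forall_norm_le).2 ⟨3 * R, ?_⟩)
  rintro q ⟨⟨a, ha, haq⟩, ⟨k, hk, hkq⟩⟩
  have ha' := hR a (Or.inl ha)
  have hk' := hR k (Or.inr hk)
  have e1 : |σ * a.1| ≤ R := by
    rw [abs_mul, hσ, one_mul]; exact (norm_fst_le a).trans ha'
  have e2 : |σ * k.1| ≤ R := by
    rw [abs_mul, hσ, one_mul]; exact (norm_fst_le k).trans hk'
  have e3 : |q.1| = |σ * q.1| := by rw [abs_mul, hσ, one_mul]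
  have h1 := (norm_nonneg _).trans haq
  have h2 := (norm_nonneg _).trans hkq
  rw [abs_le] at e1 e2
  have e4 : |σ * q.1| ≤ R := abs_le.2 ⟨by linarith, by linarith⟩
  have hq2 : ‖q.2‖ ≤ ‖q.2 - a.2‖ + ‖a.2‖ := by simpa using norm_add_le (q.2 - a.2) a.2
  have := (norm_snd_le a).trans ha'
  rw [abs_le] at e4
  have hR0 : 0 ≤ R := (norm_nonneg _).trans ha'
  refine max_le ?_ ?_
  · rw [Real.norm_eq_abs, e3, abs_le]
    constructor <;> linarith
  · linarith

/-- A closed set is half compact (past compact for `σ = 1`, future compact for `σ = -1`) if it meets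
the cones `cone (-σ) K` over compact sets `K` in compact sets. -/
def IsHalfCompact (σ : ℝ) (A : Set Spacetime) : Prop :=
  IsClosed A ∧ ∀ K : Set Spacetime, IsCompact K → IsCompact (A ∩ cone (-σ) K)

theorem isTimelikeCompact_iff {A : Set Spacetime} :
    IsTimelikeCompact A ↔ IsHalfCompact 1 A ∧ IsHalfCompact (-1) A := by
  simp only [IsTimelikeCompact, IsHalfCompact, neg_neg, cone_one, cone_neg_one]
  exact ⟨fun h => ⟨⟨h.1, fun K hK => (h.2 K hK).2⟩, ⟨h.1, fun K hK => (h.2 K hK).1⟩⟩,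
    fun h => ⟨h.1.1, fun K hK => ⟨h.2.2 K hK, h.1.2 K hK⟩⟩⟩

theorem IsHalfCompact.mono {σ : ℝ} {A B : Set Spacetime} (hB : IsHalfCompact σ B)
    (hA : IsClosed A) (h : A ⊆ B) : IsHalfCompact σ A :=
  ⟨hA, fun K hK => by
    have := (hB.2 K hK).inter_left hA
    rwa [← Set.inter_assoc, Set.inter_eq_left.2 h] at this⟩

theorem IsHalfCompact.union {σ : ℝ} {A B : Set Spacetime} (hA : IsHalfCompact σ A)
    (hB : IsHalfCompact σ B) : IsHalfCompact σ (A ∪ B) :=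
  ⟨hA.1.union hB.1, fun K hK => by
    rw [Set.union_inter_distrib_right]
    exact (hA.2 K hK).union (hB.2 K hK)⟩

theorem cone_inter_cone_subset {σ : ℝ} (A K : Set Spacetime) :
    cone σ A ∩ cone (-σ) K ⊆ cone σ (A ∩ cone (-σ) K) := by
  rintro q ⟨⟨a, ha, haq⟩, hq⟩
  refine ⟨a, ⟨ha, cone_cone_subset _ _ ⟨q, hq, ?_⟩⟩, haq⟩
  rw [norm_sub_rev]
  linarith

theorem IsHalfCompact.isClosed_cone {σ : ℝ} {A : Set Spacetime} (hA : IsHalfCompact σ A) :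
    IsClosed (cone σ A) := by
  refine IsSeqClosed.isClosed fun x q hx hq => ?_
  -- The sequence and its limit form a compact set, over which the cone is that of a compact set.
  have hK := hq.isCompact_insert_range
  refine cone_mono Set.inter_subset_left ((isClosed_cone_of_isCompact σ (hA.2 _ hK)).mem_of_tendsto
    hq (Filter.Eventually.of_forall fun n => cone_inter_cone_subset _ _ ⟨hx n, ?_⟩))
  exact subset_cone _ _ (Set.mem_insert_of_mem _ ⟨n, rfl⟩)

theorem IsHalfCompact.cone {σ : ℝ} (hσ : |σ| = 1) {A : Set Spacetime} (hA : IsHalfCompact σ A) :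
    IsHalfCompact σ (cone σ A) := by
  refine ⟨hA.isClosed_cone, fun K hK => ?_⟩
  refine (isCompact_cone_inter_cone hσ (hA.2 K hK) hK).of_isClosed_subset
    (hA.isClosed_cone.inter (isClosed_cone_of_isCompact _ hK)) fun q hq =>
    ⟨cone_inter_cone_subset _ _ hq, hq.2⟩

/-- A closed set on which `σ * t` is bounded below is half compact. -/
theorem IsHalfCompact.of_time_bounded {σ : ℝ} (hσ : |σ| = 1) {A : Set Spacetime} (hA : IsClosed A)
    (c : ℝ) (h : ∀ p ∈ A, c ≤ σ * p.1) : IsHalfCompact σ A := by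
  refine ⟨hA, fun K hK => ?_⟩
  obtain ⟨R, hR⟩ := hK.isBounded.exists_norm_le
  refine Metric.isCompact_of_isClosed_isBounded
    (hA.inter (isClosed_cone_of_isCompact _ hK))
    ((isBounded_iff_forall_norm_le).2 ⟨2 * R + |c|, ?_⟩)
  rintro q ⟨hqA, k, hk, hkq⟩
  have hk' := hR k hk
  have e2 : |σ * k.1| ≤ R := by
    rw [abs_mul, hσ, one_mul]; exact (norm_fst_le k).trans hk'
  have e3 : |q.1| = |σ * q.1| := by rw [abs_mul, hσ, one_mul]
  have h1 := (norm_nonneg _).trans hkq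
  have h2 := h q hqA
  have hc := neg_abs_le c
  rw [abs_le] at e2
  have hq2 : ‖q.2‖ ≤ ‖q.2 - k.2‖ + ‖k.2‖ := by simpa using norm_add_le (q.2 - k.2) k.2
  have := (norm_snd_le k).trans hk'
  have hR0 : 0 ≤ R := (norm_nonneg _).trans hk'
  refine max_le ?_ ?_
  · rw [Real.norm_eq_abs, e3, abs_le]
    constructor <;> linarith
  · linarith

/-! ### The invariant measure of the light cone -/

/-- The parametrization of the light cone by the spatial variable. -/
noncomputable def coneMap (σ : ℝ) (y : EuclideanSpace ℝ (Fin 3)) : Spacetime := (σ * ‖y‖, y)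

/-- The invariant measure `|y|⁻¹ dy` of the future (`σ = 1`) or past (`σ = -1`) light cone. -/
noncomputable def coneMeasure (σ : ℝ) : Measure Spacetime :=
  ((volume : Measure (EuclideanSpace ℝ (Fin 3))).withDensity
    fun y => ENNReal.ofReal ‖y‖⁻¹).map (coneMap σ)

@[fun_prop]
theorem continuous_coneMap (σ : ℝ) : Continuous (coneMap σ) := by
  unfold coneMap; fun_prop

theorem integrableOn_inv_norm_ball (R : ℝ) :
    IntegrableOn (fun y : EuclideanSpace ℝ (Fin 3) => ‖y‖⁻¹) (Metric.ball 0 R) := by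
  rw [integrableOn_fun_norm_addHaar volume (f := fun r : ℝ => r⁻¹)]
  have h : IntegrableOn (fun r : ℝ => r) (Set.Ioo 0 R) :=
    (continuous_id.integrableOn_Icc (a := 0) (b := R)).mono_set Set.Ioo_subset_Icc_self
  refine h.congr_fun (fun r hr => ?_) measurableSet_Ioo
  have : r ≠ 0 := hr.1.ne'
  simp only [finrank_euclideanSpace, Fintype.card_fin, smul_eq_mul]
  norm_num
  field_simp

instance (σ : ℝ) : IsLocallyFiniteMeasure (coneMeasure σ) := by
  refine ⟨fun p => ⟨Metric.ball 0 (‖p‖ + 1), Metric.isOpen_ball.mem_nhds (by simp), ?_⟩⟩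
  rw [coneMeasure, Measure.map_apply (continuous_coneMap σ).measurable measurableSet_ball]
  refine (measure_mono (t := Metric.ball 0 (‖p‖ + 1)) fun y hy => ?_).trans_lt ?_
  · have hy' : ‖coneMap σ y‖ < ‖p‖ + 1 := by simpa using hy
    exact mem_ball_zero_iff.2 ((norm_snd_le (coneMap σ y)).trans_lt hy')
  · rw [withDensity_apply _ measurableSet_ball]
    exact (integrableOn_inv_norm_ball _).lintegral_lt_top

variable {𝕜 : Type*} [RCLike 𝕜]

theorem integral_coneMeasure (σ : ℝ) {f : Spacetime → 𝕜} (hf : Continuous f) :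
    ∫ q, f q ∂(coneMeasure σ) = ∫ y, ‖y‖⁻¹ • f (coneMap σ y) := by
  rw [coneMeasure, integral_map (by fun_prop) hf.aestronglyMeasurable,
    integral_withDensity_eq_integral_toReal_smul (by fun_prop) (by simp)]
  congr 1; ext y
  rw [ENNReal.toReal_ofReal (by positivity)]

theorem ae_coneMeasure (σ : ℝ) {s : Set Spacetime} (hs : MeasurableSet s)
    (h : ∀ y, coneMap σ y ∈ s) : ∀ᵐ q ∂(coneMeasure σ), q ∈ s := by
  refine (ae_map_iff (continuous_coneMap σ).aemeasurable hs).2 ?_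
  exact Eventually.of_forall h

theorem neg_coneMap_mem (σ : ℝ) (hσ : |σ| = 1) (p : Spacetime) (y : EuclideanSpace ℝ (Fin 3)) :
    p - coneMap σ y ∈ cone (-σ) {p} := by
  refine ⟨p, rfl, ?_⟩
  have : σ * σ = 1 := by rw [← abs_mul_abs_self, hσ, one_mul]
  simp only [coneMap, Prod.snd_sub, Prod.fst_sub, sub_sub_cancel_left, norm_neg]
  linear_combination (-‖y‖) * this

/-- The convolution of `f` with the invariant measure of a light cone: up to a constant, the
retarded (`σ = 1`) or advanced (`σ = -1`) potential of `f`. -/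
noncomputable def conePotential (σ : ℝ) (f : Spacetime → 𝕜) (p : Spacetime) : 𝕜 :=
  ∫ q, f (p - q) ∂(coneMeasure σ)

theorem conePotential_eq_convolution (σ : ℝ) (f : Spacetime → 𝕜) :
    conePotential σ f =
      (fun _ => (1 : ℝ)) ⋆[ContinuousLinearMap.lsmul ℝ ℝ, coneMeasure σ] f := by
  ext p
  simp [conePotential, convolution_def]

theorem integrable_conePotential (σ : ℝ) {f : Spacetime → 𝕜} (hf : Continuous f)
    (hc : HasCompactSupport f) (p : Spacetime) :
    Integrable (fun q => f (p - q)) (coneMeasure σ) := by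
  have := hc.convolutionExists_right (ContinuousLinearMap.lsmul ℝ ℝ : ℝ →L[ℝ] 𝕜 →L[ℝ] 𝕜)
    (μ := coneMeasure σ) (locallyIntegrable_const (1 : ℝ)) hf p
  simpa [ConvolutionExistsAt] using this

theorem contDiff_conePotential (σ : ℝ) {f : Spacetime → 𝕜} (hf : ContDiff ℝ ∞ f)
    (hc : HasCompactSupport f) : ContDiff ℝ ∞ (conePotential σ f) := by
  rw [conePotential_eq_convolution]
  exact hc.contDiff_convolution_right (n := ⊤) _ (locallyIntegrable_const _) hf

theorem fderiv_conePotential (σ : ℝ) {f : Spacetime → 𝕜} (hf : ContDiff ℝ ∞ f)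
    (hc : HasCompactSupport f) (p v : Spacetime) :
    fderiv ℝ (conePotential σ f) p v = conePotential σ (fun q => fderiv ℝ f q v) p := by
  -- The version with a parameter is used because it does not ask the measure to be invariant.
  have hE : ∀ q : ℝ × Spacetime, fderiv ℝ ↿(fun (_ : ℝ) => f) q =
      (fderiv ℝ f q.2).comp (ContinuousLinearMap.snd ℝ ℝ Spacetime) := fun q =>
    ((hf.differentiable (by simp) q.2).hasFDerivAt.comp q hasFDerivAt_snd).fderiv
  have h := hasFDerivAt_convolution_right_with_param
    (ContinuousLinearMap.lsmul ℝ ℝ : ℝ →L[ℝ] 𝕜 →L[ℝ] 𝕜) (μ := coneMeasure σ)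
    (f := fun _ => (1 : ℝ)) (g := fun (_ : ℝ) => f) (s := Set.univ) isOpen_univ hc
    (fun _ x _ hx => image_eq_zero_of_notMem_tsupport hx) (locallyIntegrable_const _)
    ((hf.comp contDiff_snd).of_le (by norm_cast)).contDiffOn (0, p) (Set.mem_univ _)
  have h2 := h.comp p (hasFDerivAt_prodMk_right (𝕜 := ℝ) (0 : ℝ) p)
  rw [conePotential_eq_convolution, conePotential_eq_convolution]
  refine (congrArg (fun L : Spacetime →L[ℝ] 𝕜 => L v) h2.fderiv).trans ?_
  simp only [hE]
  refine (convolution_precompR_apply _ (locallyIntegrable_const _)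
    (g := fun x => (fderiv ℝ f x).comp (ContinuousLinearMap.snd ℝ ℝ Spacetime))
    ((hc.fderiv ℝ).mono fun x hx h0 => hx (by simp [h0]))
    ((hf.continuous_fderiv (by simp)).clm_comp continuous_const) p _).trans ?_
  simp

/-! ### Localization to compactly supported functions -/

/-- Near the causal past or future of a compact set a function of half compact support agrees with
one of compact support. -/
theorem exists_compact_localization {σ : ℝ} {f : smooth 𝕜}
    (hf : IsHalfCompact σ (tsupport (f : Spacetime → 𝕜))) {K : Set Spacetime} (hK : IsCompact K) :
    ∃ g : smooth 𝕜, HasCompactSupport (g : Spacetime → 𝕜) ∧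
      ∀ q ∈ cone (-σ) K, (f : Spacetime → 𝕜) =ᶠ[𝓝 q] (g : Spacetime → 𝕜) := by
  obtain ⟨R, hR⟩ := (hf.2 K hK).isBounded.exists_norm_le
  let b : ContDiffBump (0 : Spacetime) := ⟨|R| + 1, |R| + 2, by positivity, by linarith⟩
  refine ⟨⟨fun q => b q • (f : Spacetime → 𝕜) q, b.contDiff.smul (contDiff_smooth f)⟩,
    b.hasCompactSupport.smul_right, fun q hq => ?_⟩
  by_cases hqf : q ∈ tsupport (f : Spacetime → 𝕜)
  · have : Metric.ball (0 : Spacetime) (|R| + 1) ∈ 𝓝 q :=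
      Metric.isOpen_ball.mem_nhds (by
        rw [mem_ball_zero_iff]
        linarith [hR q ⟨hqf, hq⟩, le_abs_self R])
    filter_upwards [this] with x hx
    have : b x = 1 := b.one_of_mem_closedBall (Metric.ball_subset_closedBall hx)
    simp [this]
  · filter_upwards [(isClosed_tsupport _).isOpen_compl.mem_nhds hqf] with x hx
    simp [image_eq_zero_of_notMem_tsupport hx]

theorem conePotential_congr {E : Type*} {σ : ℝ} (hσ : |σ| = 1) {f g : Spacetime → E} {p : Spacetime}
    (h : ∀ q ∈ cone (-σ) {p}, f q = g q) :
    (fun q => f (p - q)) =ᵐ[coneMeasure σ] fun q => g (p - q) := by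
  have hm : MeasurableSet {q : Spacetime | p - q ∈ cone (-σ) {p}} :=
    ((isClosed_cone_of_isCompact _ isCompact_singleton).preimage (by fun_prop)).measurableSet
  filter_upwards [ae_coneMeasure σ hm (neg_coneMap_mem σ hσ p)] with q hq
  exact h _ hq

theorem conePotential_eq_of_eqOn {σ : ℝ} (hσ : |σ| = 1) {f g : Spacetime → 𝕜} {p : Spacetime}
    (h : ∀ q ∈ cone (-σ) {p}, f q = g q) : conePotential σ f p = conePotential σ g p :=
  integral_congr_ae (conePotential_congr hσ h)

theorem integrable_conePotential_of_isHalfCompact {σ : ℝ} (hσ : |σ| = 1) {f : smooth 𝕜}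
    (hf : IsHalfCompact σ (tsupport (f : Spacetime → 𝕜))) (p : Spacetime) :
    Integrable (fun q => (f : Spacetime → 𝕜) (p - q)) (coneMeasure σ) := by
  obtain ⟨g, hg, hfg⟩ := exists_compact_localization hf (isCompact_singleton (x := p))
  exact (integrable_conePotential σ (contDiff_smooth g).continuous hg p).congr
    (conePotential_congr hσ fun q hq => (hfg q hq).self_of_nhds.symm)

/-- The potential of `f` agrees near a point with that of a compactly supported function, which may
be chosen to agree with `f` near the past or future cone of the point. -/
theorem exists_conePotential_localization {σ : ℝ} (hσ : |σ| = 1) {f : smooth 𝕜}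
    (hf : IsHalfCompact σ (tsupport (f : Spacetime → 𝕜))) (p : Spacetime) :
    ∃ g : smooth 𝕜, HasCompactSupport (g : Spacetime → 𝕜) ∧
      (∀ q ∈ cone (-σ) {p}, (f : Spacetime → 𝕜) =ᶠ[𝓝 q] (g : Spacetime → 𝕜)) ∧
      conePotential σ (f : Spacetime → 𝕜) =ᶠ[𝓝 p] conePotential σ (g : Spacetime → 𝕜) := by
  obtain ⟨g, hg, hfg⟩ := exists_compact_localization hf (isCompact_closedBall p 1)
  have hsub : ∀ x ∈ Metric.closedBall p 1, cone (-σ) {x} ⊆ cone (-σ) (Metric.closedBall p 1) :=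
    fun x hx => cone_mono (Set.singleton_subset_iff.2 hx)
  refine ⟨g, hg, fun q hq => hfg q (hsub p (Metric.mem_closedBall_self zero_le_one) hq), ?_⟩
  filter_upwards [Metric.closedBall_mem_nhds p one_pos] with x hx
  exact conePotential_eq_of_eqOn hσ fun q hq => (hfg q (hsub x hx hq)).self_of_nhds

theorem contDiff_conePotential_of_isHalfCompact {σ : ℝ} (hσ : |σ| = 1) {f : smooth 𝕜}
    (hf : IsHalfCompact σ (tsupport (f : Spacetime → 𝕜))) :
    ContDiff ℝ ∞ (conePotential σ (f : Spacetime → 𝕜)) := by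
  rw [contDiff_iff_contDiffAt]
  intro p
  obtain ⟨g, hg, -, hfg⟩ := exists_conePotential_localization hσ hf p
  exact (contDiff_conePotential σ (contDiff_smooth g) hg).contDiffAt.congr_of_eventuallyEq hfg

theorem IsHalfCompact.dirDeriv {σ : ℝ} {f : smooth 𝕜}
    (hf : IsHalfCompact σ (tsupport (f : Spacetime → 𝕜))) (v : Spacetime) :
    IsHalfCompact σ (tsupport (dirDeriv v f : Spacetime → 𝕜)) :=
  hf.mono (isClosed_tsupport _) (tsupport_dirDeriv_subset v f)

theorem IsHalfCompact.waveOp {σ : ℝ} {f : smooth 𝕜}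
    (hf : IsHalfCompact σ (tsupport (f : Spacetime → 𝕜))) :
    IsHalfCompact σ (tsupport (waveOp f : Spacetime → 𝕜)) :=
  hf.mono (isClosed_tsupport _) (tsupport_waveOp_subset f)

theorem dirDeriv_eventuallyEq {f g : smooth 𝕜} {q : Spacetime}
    (h : (f : Spacetime → 𝕜) =ᶠ[𝓝 q] (g : Spacetime → 𝕜)) (v : Spacetime) :
    (dirDeriv v f : Spacetime → 𝕜) =ᶠ[𝓝 q] (dirDeriv v g : Spacetime → 𝕜) := by
  filter_upwards [h.fderiv (𝕜 := ℝ)] with x hx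
  rw [dirDeriv_apply, dirDeriv_apply, hx]

theorem waveOp_eventuallyEq {f g : smooth 𝕜} {q : Spacetime}
    (h : (f : Spacetime → 𝕜) =ᶠ[𝓝 q] (g : Spacetime → 𝕜)) :
    (waveOp f : Spacetime → 𝕜) =ᶠ[𝓝 q] (waveOp g : Spacetime → 𝕜) := by
  have h1 := fun v => dirDeriv_eventuallyEq (dirDeriv_eventuallyEq h v) v
  filter_upwards [h1 timeDir, eventually_all.2 fun i => h1 (spaceDir i)] with x hx hx'
  simp only [waveOp_apply, hx, hx']

/-- The cone potential of a smooth function of half compact support, as a smooth function. -/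
noncomputable def smoothConePotential {σ : ℝ} (hσ : |σ| = 1) (f : smooth 𝕜)
    (hf : IsHalfCompact σ (tsupport (f : Spacetime → 𝕜))) : smooth 𝕜 :=
  ⟨conePotential σ (f : Spacetime → 𝕜), contDiff_conePotential_of_isHalfCompact hσ hf⟩

theorem dirDeriv_smoothConePotential {σ : ℝ} (hσ : |σ| = 1) (f : smooth 𝕜)
    (hf : IsHalfCompact σ (tsupport (f : Spacetime → 𝕜))) (v : Spacetime) :
    dirDeriv v (smoothConePotential hσ f hf) =
      smoothConePotential hσ (dirDeriv v f) (hf.dirDeriv v) := by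
  ext p
  obtain ⟨g, hg, hfg, hpot⟩ := exists_conePotential_localization hσ hf p
  change fderiv ℝ (conePotential σ (f : Spacetime → 𝕜)) p v = conePotential σ _ p
  rw [hpot.fderiv_eq, fderiv_conePotential σ (contDiff_smooth g) hg]
  exact conePotential_eq_of_eqOn hσ fun q hq => by
    rw [dirDeriv_apply, (hfg q hq).fderiv_eq]

/-- The potential commutes with the wave operator. -/
theorem waveOp_smoothConePotential {σ : ℝ} (hσ : |σ| = 1) (f : smooth 𝕜)
    (hf : IsHalfCompact σ (tsupport (f : Spacetime → 𝕜))) :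
    waveOp (smoothConePotential hσ f hf) = smoothConePotential hσ (waveOp f) hf.waveOp := by
  have hi := fun v => integrable_conePotential_of_isHalfCompact hσ ((hf.dirDeriv v).dirDeriv v)
  ext p
  rw [waveOp_apply]
  simp only [dirDeriv_smoothConePotential]
  change -(∫ q, _ ∂_) + ∑ i, ∫ q, _ ∂_ = ∫ q, _ ∂_
  simp only [waveOp_apply]
  refine Eq.symm ((integral_add (hi _ p).neg (integrable_finsetSum _ fun i _ => hi _ p)).trans ?_)
  rw [integral_finsetSum _ fun i _ => hi _ p]
  exact congrArg (· + _) (integral_neg _)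

theorem support_conePotential_subset {σ : ℝ} (hσ : |σ| = 1) (f : Spacetime → 𝕜) :
    Function.support (conePotential σ f) ⊆ cone σ (tsupport f) := by
  intro p hp
  by_contra h
  refine hp ?_
  have : conePotential σ f p = conePotential σ (fun _ => (0 : 𝕜)) p := by
    refine conePotential_eq_of_eqOn hσ fun q ⟨p', hp', hq⟩ => ?_
    obtain rfl : p' = p := hp'
    by_contra hq0
    refine h ⟨q, subset_tsupport f hq0, ?_⟩
    rw [norm_sub_rev]
    linarith
  simpa [conePotential] using this

theorem tsupport_conePotential_subset {σ : ℝ} (hσ : |σ| = 1) {f : Spacetime → 𝕜}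
    (hf : IsHalfCompact σ (tsupport f)) : tsupport (conePotential σ f) ⊆ cone σ (tsupport f) :=
  closure_minimal (support_conePotential_subset hσ f) hf.isClosed_cone

/-! ### Kirchhoff's formula -/

/-- A smooth monotone step, equal to `0` on `(-∞, 1]` and to `1` on `[2, ∞)`. -/
noncomputable def smoothStep (s : ℝ) : ℝ := Real.smoothTransition (s - 1)

theorem contDiff_smoothStep : ContDiff ℝ ∞ smoothStep :=
  (Real.smoothTransition.contDiff (n := ⊤)).comp (contDiff_id.sub contDiff_const)

theorem smoothStep_of_le {s : ℝ} (h : s ≤ 1) : smoothStep s = 0 :=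
  Real.smoothTransition.zero_of_nonpos (by linarith)

theorem smoothStep_of_ge {s : ℝ} (h : 2 ≤ s) : smoothStep s = 1 :=
  Real.smoothTransition.one_of_one_le (by linarith)

theorem continuous_deriv_smoothStep : Continuous (deriv smoothStep) :=
  contDiff_smoothStep.continuous_deriv (by simp)

theorem hasDerivAt_smoothStep (s : ℝ) : HasDerivAt smoothStep (deriv smoothStep s) s :=
  (contDiff_smoothStep.differentiable (by simp) s).hasDerivAt

theorem deriv_smoothStep_nonneg (s : ℝ) : 0 ≤ deriv smoothStep s :=
  Monotone.deriv_nonneg (Real.smoothTransition.monotone.comp fun a b h => by simpa using h)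

theorem deriv_smoothStep_of_lt {s : ℝ} (h : s < 1) : deriv smoothStep s = 0 := by
  have : smoothStep =ᶠ[𝓝 s] fun _ => 0 := by
    filter_upwards [Iio_mem_nhds h] with x hx using smoothStep_of_le (le_of_lt hx)
  rw [this.deriv_eq, deriv_const]

theorem deriv_smoothStep_of_gt {s : ℝ} (h : 2 < s) : deriv smoothStep s = 0 := by
  have : smoothStep =ᶠ[𝓝 s] fun _ => 1 := by
    filter_upwards [Ioi_mem_nhds h] with x hx using smoothStep_of_ge (le_of_lt hx)
  rw [this.deriv_eq, deriv_const]

theorem continuous_comp_norm_sq_mul_inv {k : ℝ → ℝ} (hk : Continuous k) (h0 : ∀ s < 1, k s = 0)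
    (ε : ℝ) :
    Continuous fun y : EuclideanSpace ℝ (Fin 3) => k (‖y‖ ^ 2 / ε ^ 2) * ‖y‖⁻¹ := by
  rw [continuous_iff_continuousAt]
  intro y
  by_cases hy : y = 0
  · have : (fun y : EuclideanSpace ℝ (Fin 3) => k (‖y‖ ^ 2 / ε ^ 2) * ‖y‖⁻¹) =ᶠ[𝓝 y]
        fun _ => 0 := by
      have h1 : ContinuousAt (fun y : EuclideanSpace ℝ (Fin 3) => ‖y‖ ^ 2 / ε ^ 2) y := by
        fun_prop
      filter_upwards [h1.eventually_lt (continuousAt_const (y := (1 : ℝ))) (by simp [hy])]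
        with x hx
      rw [h0 _ hx, zero_mul]
    exact continuousAt_const.congr this.symm
  · have : ‖y‖ ≠ 0 := norm_ne_zero_iff.2 hy
    exact ContinuousAt.mul (by fun_prop) (by fun_prop (disch := assumption))

theorem hasCompactSupport_deriv_smoothStep_norm_sq :
    HasCompactSupport fun y : EuclideanSpace ℝ (Fin 3) => deriv smoothStep (‖y‖ ^ 2) := by
  refine HasCompactSupport.intro (isCompact_closedBall 0 2) fun y hy => ?_
  have hy' : 2 < ‖y‖ := by simpa using hy
  exact deriv_smoothStep_of_gt (by nlinarith)

/-- The constant `4π`, in the form in which it arises from the cutoff of the singularity; only its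
positivity matters. -/
noncomputable def kirchhoffConst : ℝ :=
  ∫ y : EuclideanSpace ℝ (Fin 3), 2 * deriv smoothStep (‖y‖ ^ 2) * ‖y‖⁻¹

theorem continuous_kirchhoffConst_integrand :
    Continuous fun y : EuclideanSpace ℝ (Fin 3) => 2 * deriv smoothStep (‖y‖ ^ 2) * ‖y‖⁻¹ := by
  have := continuous_comp_norm_sq_mul_inv continuous_deriv_smoothStep
    (fun s => deriv_smoothStep_of_lt) 1
  simpa [mul_assoc] using this.const_mul 2

theorem kirchhoffConst_pos : 0 < kirchhoffConst := by
  obtain ⟨s, hs, hs'⟩ := exists_deriv_eq_slope smoothStep (a := 1) (b := 2) (by norm_num)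
    contDiff_smoothStep.continuous.continuousOn
    (contDiff_smoothStep.differentiable (by simp)).differentiableOn
  rw [smoothStep_of_le le_rfl, smoothStep_of_ge le_rfl] at hs'
  have hs0 : 0 < s := by linarith [hs.1]
  refine continuous_kirchhoffConst_integrand.integral_pos_of_hasCompactSupport_nonneg_nonzero
    (hasCompactSupport_deriv_smoothStep_norm_sq.mul_left.mul_right)
    (fun y => mul_nonneg (mul_nonneg (by norm_num) (deriv_smoothStep_nonneg _)) (by positivity))
    (x := EuclideanSpace.single 0 (√s)) ?_
  simp only [PiLp.norm_single, Real.norm_eq_abs, sq_abs, Real.sq_sqrt hs0.le, hs']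
  have : √s ≠ 0 := (Real.sqrt_pos.2 hs0).ne'
  simp [this]
  norm_num

theorem integral_fderiv_eq_zero {f : EuclideanSpace ℝ (Fin 3) → 𝕜} (hf : ContDiff ℝ 1 f)
    (hc : HasCompactSupport f) (v : EuclideanSpace ℝ (Fin 3)) :
    ∫ y, fderiv ℝ f y v = 0 := by
  have hi : Integrable fun y => fderiv ℝ f y v :=
    ((hf.continuous_fderiv one_ne_zero).clm_apply continuous_const).integrable_of_hasCompactSupport
      (hc.fderiv_apply ℝ v)
  have := integral_smul_fderiv_eq_neg_fderiv_smul_of_integrable (μ := volume) (𝕜 := ℝ)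
    (f := fun _ : EuclideanSpace ℝ (Fin 3) => (1 : ℝ)) (g := f) (v := v) (by simp)
    (by simpa using hi) (by simpa using hf.continuous.integrable_of_hasCompactSupport hc)
    (fun _ _ => differentiableAt_const _) (fun y _ => hf.differentiable one_ne_zero y)
  simpa using this

theorem exists_radius_notMem_tsupport (σ : ℝ) {g : Spacetime → 𝕜}
    (hc : HasCompactSupport g) (p : Spacetime) :
    ∃ R, ∀ y ∉ Metric.closedBall (0 : EuclideanSpace ℝ (Fin 3)) R,
      p - coneMap σ y ∉ tsupport g := by
  obtain ⟨R, hR⟩ := hc.isCompact.isBounded.exists_norm_le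
  refine ⟨‖p‖ + R, fun y hy h => hy ?_⟩
  have h1 := hR _ h
  have h2 : ‖coneMap σ y‖ ≤ ‖p‖ + ‖p - coneMap σ y‖ := by
    simpa using norm_sub_le p (p - coneMap σ y)
  rw [mem_closedBall_zero_iff]
  exact (norm_snd_le (coneMap σ y)).trans (by linarith)

/-! ### Derivatives of functions on the light cone along coordinate lines -/

theorem norm_sq_eq_coord (y : EuclideanSpace ℝ (Fin 3)) : ‖y‖ ^ 2 = ∑ i, y i ^ 2 := by
  rw [EuclideanSpace.norm_sq_eq]; simp

theorem hasDerivAt_norm_line {y : EuclideanSpace ℝ (Fin 3)} (hy : y ≠ 0) (i : Fin 3) :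
    HasDerivAt (fun s : ℝ => ‖y + s • EuclideanSpace.single i (1 : ℝ)‖) (‖y‖⁻¹ * y i) 0 := by
  have h0 : ‖y‖ ≠ 0 := norm_ne_zero_iff.2 hy
  have hl : HasDerivAt (fun s : ℝ => y + s • EuclideanSpace.single i (1 : ℝ))
      (EuclideanSpace.single i (1 : ℝ)) 0 := by
    simpa using ((hasDerivAt_id (0 : ℝ)).smul_const (EuclideanSpace.single i (1 : ℝ))).const_add y
  have h1 := hl.norm_sq.sqrt (by simpa using h0)
  simp only [Real.sqrt_sq (norm_nonneg _), zero_smul, add_zero] at h1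
  convert h1 using 1
  rw [EuclideanSpace.inner_single_right]
  simp
  field_simp

theorem hasDerivAt_coord_line (y : EuclideanSpace ℝ (Fin 3)) (i : Fin 3) :
    HasDerivAt (fun s : ℝ => (y + s • EuclideanSpace.single i (1 : ℝ)) i) 1 0 := by
  simpa using (hasDerivAt_id (0 : ℝ)).const_add (y i)

theorem hasDerivAt_comp_coneMap_line (σ : ℝ) (g : smooth 𝕜) (p : Spacetime)
    {y : EuclideanSpace ℝ (Fin 3)} (hy : y ≠ 0) (i : Fin 3) :
    HasDerivAt (fun s : ℝ => (g : Spacetime → 𝕜)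
        (p - coneMap σ (y + s • EuclideanSpace.single i (1 : ℝ))))
      (-((σ * (‖y‖⁻¹ * y i)) • (dirDeriv timeDir g : Spacetime → 𝕜) (p - coneMap σ y)) -
        (dirDeriv (spaceDir i) g : Spacetime → 𝕜) (p - coneMap σ y)) 0 := by
  have hl : HasDerivAt (fun s : ℝ => y + s • EuclideanSpace.single i (1 : ℝ))
      (EuclideanSpace.single i (1 : ℝ)) 0 := by
    simpa using ((hasDerivAt_id (0 : ℝ)).smul_const (EuclideanSpace.single i (1 : ℝ))).const_add y
  have h1 : HasDerivAt (fun s : ℝ => p - coneMap σ (y + s • EuclideanSpace.single i (1 : ℝ)))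
      (-(σ * (‖y‖⁻¹ * y i)) • timeDir - spaceDir i) 0 := by
    have := (((hasDerivAt_norm_line hy i).const_mul σ).prodMk hl).const_sub p
    have e : -(σ * (‖y‖⁻¹ * y i)) • timeDir - spaceDir i =
        -(σ * (‖y‖⁻¹ * y i), EuclideanSpace.single i (1 : ℝ)) := by
      ext <;> simp [timeDir, spaceDir]
    rw [e]
    exact this
  have hg : HasFDerivAt (g : Spacetime → 𝕜) (fderiv ℝ (g : Spacetime → 𝕜) (p - coneMap σ y))
      (p - coneMap σ (y + (0 : ℝ) • EuclideanSpace.single i (1 : ℝ))) := by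
    simpa using (smooth_differentiable g (p - coneMap σ y)).hasFDerivAt
  have := hg.comp_hasDerivAt (0 : ℝ) h1
  rw [map_sub, map_smul, neg_smul] at this
  exact this

/-! ### The cut-off vector field and its divergence -/

/-- The components of the vector field on `ℝ³` whose divergence, where the cutoff is `1`, is
`|y|⁻¹ (P f)(p - (σ|y|, y))`. -/
noncomputable def kirchhoffField (σ ε : ℝ) (f : smooth 𝕜) (p : Spacetime) (i : Fin 3)
    (y : EuclideanSpace ℝ (Fin 3)) : 𝕜 :=
  smoothStep (‖y‖ ^ 2 / ε ^ 2) •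
    ((σ * (‖y‖⁻¹ ^ 2 * y i)) • (dirDeriv timeDir f : Spacetime → 𝕜) (p - coneMap σ y)
      - ‖y‖⁻¹ • (dirDeriv (spaceDir i) f : Spacetime → 𝕜) (p - coneMap σ y)
      + (‖y‖⁻¹ ^ 3 * y i) • (f : Spacetime → 𝕜) (p - coneMap σ y))

/-- The boundary term, concentrated where the cutoff varies. -/
noncomputable def kirchhoffBoundary (σ ε : ℝ) (f : smooth 𝕜) (p : Spacetime)
    (y : EuclideanSpace ℝ (Fin 3)) : 𝕜 :=
  (deriv smoothStep (‖y‖ ^ 2 / ε ^ 2) * (2 / ε ^ 2)) •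
    (σ • (dirDeriv timeDir f : Spacetime → 𝕜) (p - coneMap σ y)
      - ∑ i, (‖y‖⁻¹ * y i) • (dirDeriv (spaceDir i) f : Spacetime → 𝕜) (p - coneMap σ y)
      + ‖y‖⁻¹ • (f : Spacetime → 𝕜) (p - coneMap σ y))

theorem kirchhoffField_eventuallyEq_zero {σ ε : ℝ} (f : smooth 𝕜) (p : Spacetime)
    (i : Fin 3) : kirchhoffField σ ε f p i =ᶠ[𝓝 0] 0 := by
  have h1 : ContinuousAt (fun y : EuclideanSpace ℝ (Fin 3) => ‖y‖ ^ 2 / ε ^ 2) 0 := by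
    fun_prop
  filter_upwards [h1.eventually_lt (continuousAt_const (y := (1 : ℝ))) (by simp)] with x hx
  simp [kirchhoffField, smoothStep_of_le hx.le]

theorem contDiffAt_comp_coneMap (σ : ℝ) (g : smooth 𝕜) (p : Spacetime)
    {y : EuclideanSpace ℝ (Fin 3)} (hy : y ≠ 0) :
    ContDiffAt ℝ 1 (fun y => (g : Spacetime → 𝕜) (p - coneMap σ y)) y := by
  refine ((contDiff_smooth g).of_le (by norm_cast)).contDiffAt.comp y ?_
  exact contDiffAt_const.sub ((contDiffAt_const.mul (contDiffAt_norm ℝ hy)).prodMk contDiffAt_id)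

theorem contDiff_kirchhoffField (σ ε : ℝ) (f : smooth 𝕜) (p : Spacetime) (i : Fin 3) :
    ContDiff ℝ 1 (kirchhoffField σ ε f p i) := by
  rw [contDiff_iff_contDiffAt]
  intro y
  by_cases hy : y = 0
  · subst hy
    exact contDiffAt_const.congr_of_eventuallyEq (kirchhoffField_eventuallyEq_zero f p i)
  · have hn : ContDiffAt ℝ 1 (fun y : EuclideanSpace ℝ (Fin 3) => ‖y‖) y := contDiffAt_norm ℝ hy
    have hi := hn.inv (norm_ne_zero_iff.2 hy)
    have hc : ContDiffAt ℝ 1 (fun y : EuclideanSpace ℝ (Fin 3) => y i) y := by fun_prop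
    have hp := fun g : smooth 𝕜 => contDiffAt_comp_coneMap σ g p hy
    have hs : ContDiffAt ℝ 1
        (fun y : EuclideanSpace ℝ (Fin 3) => smoothStep (‖y‖ ^ 2 / ε ^ 2)) y :=
      (contDiff_smoothStep.of_le (by norm_cast)).contDiffAt.comp y ((hn.pow 2).div_const _)
    have h1 : ContDiffAt ℝ 1 (fun y : EuclideanSpace ℝ (Fin 3) => σ * (‖y‖⁻¹ ^ 2 * y i)) y :=
      contDiffAt_const.mul ((hi.pow 2).mul hc)
    have h2 : ContDiffAt ℝ 1 (fun y : EuclideanSpace ℝ (Fin 3) => ‖y‖⁻¹ ^ 3 * y i) y :=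
      (hi.pow 3).mul hc
    exact hs.smul (((h1.smul (hp (dirDeriv timeDir f))).sub
      (hi.smul (hp (dirDeriv (spaceDir i) f)))).add (h2.smul (hp f)))

theorem hasCompactSupport_kirchhoffField (σ ε : ℝ) {f : smooth 𝕜}
    (hc : HasCompactSupport (f : Spacetime → 𝕜)) (p : Spacetime) (i : Fin 3) :
    HasCompactSupport (kirchhoffField σ ε f p i) := by
  obtain ⟨R, hR⟩ := exists_radius_notMem_tsupport σ hc p
  refine HasCompactSupport.intro (isCompact_closedBall 0 R) fun y hy => ?_
  have h := fun v => image_eq_zero_of_notMem_tsupport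
    (mt (fun h => tsupport_dirDeriv_subset v f h) (hR y hy))
  simp [kirchhoffField, h, image_eq_zero_of_notMem_tsupport (hR y hy)]

theorem dirDeriv_comm (v w : Spacetime) (f : smooth 𝕜) :
    dirDeriv v (dirDeriv w f) = dirDeriv w (dirDeriv v f) := by
  have key : ∀ (a b p : Spacetime), (dirDeriv a (dirDeriv b f) : Spacetime → 𝕜) p =
      fderiv ℝ (fderiv ℝ (f : Spacetime → 𝕜)) p a b := by
    intro a b p
    have hd : DifferentiableAt ℝ (fderiv ℝ (f : Spacetime → 𝕜)) p :=
      ((contDiff_smooth f).fderiv_right (m := ∞) (by simp)).differentiable (by simp) p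
    have := (hd.hasFDerivAt.clm_apply (hasFDerivAt_const b p)).fderiv
    rw [dirDeriv_apply]
    refine (congrArg (fun L : Spacetime →L[ℝ] 𝕜 => L a) this).trans ?_
    simp
  ext p
  rw [key, key]
  exact ((contDiff_smooth f).contDiffAt.isSymmSndFDerivAt
    (by rw [minSmoothness_of_isRCLikeNormedField]; exact WithTop.coe_le_coe.2 le_top)) v w

/-- The divergence of the field. -/
theorem sum_fderiv_kirchhoffField {σ ε : ℝ} (hσ : |σ| = 1) (f : smooth 𝕜) (p : Spacetime)
    (y : EuclideanSpace ℝ (Fin 3)) :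
    ∑ i, fderiv ℝ (kirchhoffField σ ε f p i) y (EuclideanSpace.single i 1) =
      (smoothStep (‖y‖ ^ 2 / ε ^ 2) * ‖y‖⁻¹) • (waveOp f : Spacetime → 𝕜) (p - coneMap σ y) +
        kirchhoffBoundary σ ε f p y := by
  by_cases hy : y = 0
  · subst hy
    have h0 : ∀ i, fderiv ℝ (kirchhoffField σ ε f p i) 0 = 0 := fun i => by
      rw [(kirchhoffField_eventuallyEq_zero f p i).fderiv_eq]
      exact fderiv_const_apply _
    simp [h0, kirchhoffBoundary, smoothStep_of_le zero_le_one, deriv_smoothStep_of_lt zero_lt_one]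
  have hr : ‖y‖ ≠ 0 := norm_ne_zero_iff.2 hy
  have hσ2 : σ * σ = 1 := by rw [← abs_mul_abs_self, hσ, one_mul]
  have hsq : ‖y‖⁻¹ ^ 2 * (y 0 ^ 2 + y 1 ^ 2 + y 2 ^ 2) = 1 := by
    have := norm_sq_eq_coord y
    rw [Fin.sum_univ_three] at this
    rw [← this]; field_simp
  have hD : ∀ i, fderiv ℝ (kirchhoffField σ ε f p i) y (EuclideanSpace.single i 1) =
      deriv (fun s : ℝ => kirchhoffField σ ε f p i (y + s • EuclideanSpace.single i 1)) 0 :=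
    fun i => by
      have hd := ((contDiff_kirchhoffField σ ε f p i).differentiable one_ne_zero y)
      exact hd.lineDeriv_eq_fderiv.symm
  have hder : ∀ i, HasDerivAt
      (fun s : ℝ => kirchhoffField σ ε f p i (y + s • EuclideanSpace.single i 1)) _ 0 := fun i => by
    have hn := hasDerivAt_norm_line hy i
    have hinv := hn.fun_inv (by simpa using hr)
    have hc := hasDerivAt_coord_line y i
    have hstep := (hasDerivAt_smoothStep (‖y + (0 : ℝ) • EuclideanSpace.single i (1 : ℝ)‖ ^ 2
      / ε ^ 2)).comp (0 : ℝ) ((hn.fun_pow 2).div_const (ε ^ 2))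
    exact hstep.fun_smul (((((hinv.fun_pow 2).fun_mul hc).const_mul σ).fun_smul
      (hasDerivAt_comp_coneMap_line σ (dirDeriv timeDir f) p hy i)).fun_sub
      (hinv.fun_smul (hasDerivAt_comp_coneMap_line σ (dirDeriv (spaceDir i) f) p hy i)) |>.fun_add
      (((hinv.fun_pow 3).fun_mul hc).fun_smul (hasDerivAt_comp_coneMap_line σ f p hy i)))
  simp only [hD, fun i => (hder i).deriv]
  simp only [Fin.sum_univ_three, zero_smul, add_zero, kirchhoffBoundary, waveOp_apply,
    Function.comp_apply, dirDeriv_comm timeDir, RCLike.real_smul_eq_coe_mul]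
  push_cast
  have hρ : (‖y‖ : 𝕜) * (‖y‖ : 𝕜)⁻¹ = 1 :=
    mul_inv_cancel₀ (by exact_mod_cast hr)
  have hσ' : (σ : 𝕜) * σ = 1 := by exact_mod_cast hσ2
  have hsq' : (‖y‖ : 𝕜)⁻¹ ^ 2 * ((y 0 : 𝕜) ^ 2 + (y 1 : 𝕜) ^ 2 + (y 2 : 𝕜) ^ 2) = 1 := by
    exact_mod_cast congrArg (fun x : ℝ => (x : 𝕜)) hsq
  clear hder hD
  set χ' := ((deriv smoothStep (‖y‖ ^ 2 / ε ^ 2) : ℝ) : 𝕜)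
  set χ := ((smoothStep (‖y‖ ^ 2 / ε ^ 2) : ℝ) : 𝕜)
  set ftt := (dirDeriv timeDir (dirDeriv timeDir f) : Spacetime → 𝕜) (p - coneMap σ y)
  set ft := (dirDeriv timeDir f : Spacetime → 𝕜) (p - coneMap σ y)
  set f0 := (dirDeriv (spaceDir 0) f : Spacetime → 𝕜) (p - coneMap σ y)
  set f1 := (dirDeriv (spaceDir 1) f : Spacetime → 𝕜) (p - coneMap σ y)
  set f2 := (dirDeriv (spaceDir 2) f : Spacetime → 𝕜) (p - coneMap σ y)
  set u := (f : Spacetime → 𝕜) (p - coneMap σ y)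
  set ρ := (‖y‖ : 𝕜)⁻¹
  set a := (y 0 : 𝕜)
  set b := (y 1 : 𝕜)
  set c := (y 2 : 𝕜)
  linear_combination (-χ * ρ ^ 3 * ftt * (a ^ 2 + b ^ 2 + c ^ 2)) * hσ' +
    (-χ * ρ * ftt - 3 * χ * σ * ρ ^ 2 * ft - 3 * χ * ρ ^ 3 * u +
      2 * χ' * (ε : 𝕜)⁻¹ ^ 2 * (σ * ft + ρ * u)) * hsq' +
    2 * χ' * (ε : 𝕜)⁻¹ ^ 2 * (ρ ^ 2 * (a ^ 2 + b ^ 2 + c ^ 2) * (σ * ft + ρ * u) -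
      ρ * (a * f0 + b * f1 + c * f2)) * hρ

open MeasureTheory Filter Topology

/-! ### Removing the cutoff -/

theorem HasCompactSupport.dirDeriv {f : smooth 𝕜}
    (hc : HasCompactSupport (f : Spacetime → 𝕜)) (v : Spacetime) :
    HasCompactSupport (dirDeriv v f : Spacetime → 𝕜) :=
  hc.of_isClosed_subset (isClosed_tsupport _) (tsupport_dirDeriv_subset v f)

theorem HasCompactSupport.waveOp {f : smooth 𝕜}
    (hc : HasCompactSupport (f : Spacetime → 𝕜)) :
    HasCompactSupport (waveOp f : Spacetime → 𝕜) :=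
  hc.of_isClosed_subset (isClosed_tsupport _) (tsupport_waveOp_subset f)

theorem continuous_smooth (f : smooth 𝕜) : Continuous (f : Spacetime → 𝕜) :=
  (contDiff_smooth f).continuous

/-- The divergence theorem for the cut-off field. -/
theorem integral_smoothStep_smul_waveOp {σ : ℝ} (hσ : |σ| = 1) (ε : ℝ) {f : smooth 𝕜}
    (hc : HasCompactSupport (f : Spacetime → 𝕜)) (p : Spacetime) :
    ∫ y, (smoothStep (‖y‖ ^ 2 / ε ^ 2) * ‖y‖⁻¹) •
        (waveOp f : Spacetime → 𝕜) (p - coneMap σ y) =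
      -∫ y, kirchhoffBoundary σ ε f p y := by
  have hi : ∀ i, Integrable fun y =>
      fderiv ℝ (kirchhoffField σ ε f p i) y (EuclideanSpace.single i 1) := fun i =>
    (((contDiff_kirchhoffField σ ε f p i).continuous_fderiv one_ne_zero).clm_apply
      continuous_const).integrable_of_hasCompactSupport
      ((hasCompactSupport_kirchhoffField σ ε hc p i).fderiv_apply ℝ _)
  have h0 : ∫ y, ∑ i, fderiv ℝ (kirchhoffField σ ε f p i) y (EuclideanSpace.single i 1) = 0 := by
    rw [integral_finsetSum _ fun i _ => hi i]
    exact Finset.sum_eq_zero fun i _ => integral_fderiv_eq_zero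
      (contDiff_kirchhoffField σ ε f p i) (hasCompactSupport_kirchhoffField σ ε hc p i) _
  obtain ⟨R, hR⟩ := exists_radius_notMem_tsupport σ (HasCompactSupport.waveOp hc) p
  have h1 : Integrable fun y : EuclideanSpace ℝ (Fin 3) =>
      (smoothStep (‖y‖ ^ 2 / ε ^ 2) * ‖y‖⁻¹) •
        (waveOp f : Spacetime → 𝕜) (p - coneMap σ y) := by
    refine Continuous.integrable_of_hasCompactSupport ?_
      (HasCompactSupport.intro (isCompact_closedBall 0 R) fun y hy => ?_)
    · exact (continuous_comp_norm_sq_mul_inv contDiff_smoothStep.continuous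
        (fun s hs => smoothStep_of_le hs.le) ε).smul
        ((continuous_smooth _).comp (continuous_const.sub (continuous_coneMap σ)))
    · rw [image_eq_zero_of_notMem_tsupport (hR y hy), smul_zero]
  have h2 : Integrable fun y => kirchhoffBoundary σ ε f p y := by
    refine ((integrable_finsetSum Finset.univ fun i _ => hi i).sub h1).congr
      (Eventually.of_forall fun y => ?_)
    simp only [Pi.sub_apply, sum_fderiv_kirchhoffField hσ, add_sub_cancel_left]
  simp only [sum_fderiv_kirchhoffField hσ] at h0
  rw [integral_add h1 h2] at h0
  exact eq_neg_of_add_eq_zero_left h0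

/-- The boundary term, rescaled to unit scale. -/
noncomputable def kirchhoffRescaled (σ ε : ℝ) (f : smooth 𝕜) (p : Spacetime)
    (x : EuclideanSpace ℝ (Fin 3)) : 𝕜 :=
  (2 * deriv smoothStep (‖x‖ ^ 2)) •
    (ε • (σ • (dirDeriv timeDir f : Spacetime → 𝕜) (p - coneMap σ (ε • x))
      - ∑ i, (‖x‖⁻¹ * x i) • (dirDeriv (spaceDir i) f : Spacetime → 𝕜) (p - coneMap σ (ε • x)))
      + ‖x‖⁻¹ • (f : Spacetime → 𝕜) (p - coneMap σ (ε • x)))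

theorem integral_kirchhoffBoundary (σ : ℝ) {ε : ℝ} (hε : 0 < ε) (f : smooth 𝕜) (p : Spacetime) :
    ∫ y, kirchhoffBoundary σ ε f p y = ∫ x, kirchhoffRescaled σ ε f p x := by
  have h := Measure.integral_comp_smul (μ := volume) (kirchhoffBoundary σ ε f p) ε
  rw [finrank_euclideanSpace, Fintype.card_fin, abs_of_pos (by positivity)] at h
  have h' : ∫ y, kirchhoffBoundary σ ε f p y =
      (ε ^ 3) • ∫ x, kirchhoffBoundary σ ε f p (ε • x) := by
    rw [h, smul_smul, mul_inv_cancel₀ (by positivity), one_smul]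
  rw [h', ← integral_smul]
  congr 1
  ext x
  have e1 : ‖ε • x‖ ^ 2 / ε ^ 2 = ‖x‖ ^ 2 := by
    rw [norm_smul, Real.norm_of_nonneg hε.le]; field_simp
  have e2 : ∀ i, ‖ε • x‖⁻¹ * (ε • x) i = ‖x‖⁻¹ * x i := fun i => by
    rw [norm_smul, Real.norm_of_nonneg hε.le]
    by_cases hx : x = 0
    · simp [hx]
    · have : ‖x‖ ≠ 0 := norm_ne_zero_iff.2 hx
      simp only [PiLp.smul_apply, smul_eq_mul]
      field_simp
  have e3 : ‖ε • x‖⁻¹ = ε⁻¹ * ‖x‖⁻¹ := by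
    rw [norm_smul, Real.norm_of_nonneg hε.le, mul_inv]
  simp only [kirchhoffBoundary, kirchhoffRescaled, e1, e2]
  rw [e3]
  simp only [smul_smul, smul_add, smul_sub, Finset.smul_sum]
  have hε' := hε.ne'
  congr 1
  · congr 1
    · congr 1; field_simp
    · refine Finset.sum_congr rfl fun i _ => ?_
      congr 1; field_simp
  · congr 1; field_simp

/-- As the cutoff around the vertex shrinks, the boundary term converges to a multiple of the value
at the vertex. -/
theorem tendsto_integral_kirchhoffBoundary (σ : ℝ) {f : smooth 𝕜}
    (hc : HasCompactSupport (f : Spacetime → 𝕜)) (p : Spacetime) :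
    Tendsto (fun ε => ∫ y, kirchhoffBoundary σ ε f p y) (𝓝[>] 0)
      (𝓝 (kirchhoffConst • (f : Spacetime → 𝕜) p)) := by
  obtain ⟨C, hC⟩ := (continuous_smooth f).bounded_above_of_compact_support hc
  obtain ⟨Ct, hCt⟩ := (continuous_smooth (dirDeriv timeDir f)).bounded_above_of_compact_support
    (HasCompactSupport.dirDeriv hc _)
  choose Cs hCs using fun i => (continuous_smooth
    (dirDeriv (spaceDir i) f)).bounded_above_of_compact_support (HasCompactSupport.dirDeriv hc _)
  have hlim : kirchhoffConst • (f : Spacetime → 𝕜) p = ∫ x : EuclideanSpace ℝ (Fin 3),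
      (2 * deriv smoothStep (‖x‖ ^ 2)) • (‖x‖⁻¹ • (f : Spacetime → 𝕜) p) := by
    rw [kirchhoffConst, ← integral_smul_const]
    simp only [smul_smul]
  rw [hlim]
  have hcongr : ∀ᶠ ε in 𝓝[>] (0 : ℝ),
      ∫ x, kirchhoffRescaled σ ε f p x = ∫ y, kirchhoffBoundary σ ε f p y := by
    filter_upwards [self_mem_nhdsWithin] with ε hε
    exact (integral_kirchhoffBoundary σ hε f p).symm
  refine Tendsto.congr' hcongr ?_
  have hint : Integrable fun x : EuclideanSpace ℝ (Fin 3) =>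
      (2 * deriv smoothStep (‖x‖ ^ 2)) * (|σ| * Ct + ∑ i, Cs i) +
        (2 * deriv smoothStep (‖x‖ ^ 2) * ‖x‖⁻¹) * C := by
    refine Integrable.add (Integrable.mul_const ?_ _) (Integrable.mul_const ?_ _)
    · exact Continuous.integrable_of_hasCompactSupport
        (continuous_const.mul (continuous_deriv_smoothStep.comp (by fun_prop)))
        hasCompactSupport_deriv_smoothStep_norm_sq.mul_left
    · exact continuous_kirchhoffConst_integrand.integrable_of_hasCompactSupport
        hasCompactSupport_deriv_smoothStep_norm_sq.mul_left.mul_right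
  refine tendsto_integral_filter_of_dominated_convergence _ ?_ ?_ hint ?_
  · refine Eventually.of_forall fun ε => ?_
    have hm : ∀ g : smooth 𝕜, AEStronglyMeasurable (fun x : EuclideanSpace ℝ (Fin 3) =>
        (g : Spacetime → 𝕜) (p - coneMap σ (ε • x))) := fun g =>
      ((continuous_smooth g).comp (continuous_const.sub ((continuous_coneMap σ).comp
        (continuous_const_smul ε)))).aestronglyMeasurable
    have hθ : AEStronglyMeasurable fun x : EuclideanSpace ℝ (Fin 3) =>
        2 * deriv smoothStep (‖x‖ ^ 2) :=
      (continuous_const.mul (continuous_deriv_smoothStep.comp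
        (by fun_prop))).aestronglyMeasurable
    have hn : AEStronglyMeasurable fun x : EuclideanSpace ℝ (Fin 3) => ‖x‖⁻¹ :=
      (measurable_norm.inv).aestronglyMeasurable
    refine hθ.smul ((((hm _).const_smul σ).sub ?_).const_smul ε |>.add (hn.smul (hm f)))
    refine Finset.aestronglyMeasurable_fun_sum _ fun i _ => ?_
    exact (hn.mul (by fun_prop : Continuous fun x : EuclideanSpace ℝ (Fin 3) =>
      x i).aestronglyMeasurable).smul (hm _)
  · have hε1 : ∀ᶠ ε in 𝓝[>] (0 : ℝ), ε < 1 := nhdsWithin_le_nhds (Iio_mem_nhds one_pos)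
    filter_upwards [self_mem_nhdsWithin, hε1] with ε (hε : 0 < ε) hε1
    refine Eventually.of_forall fun x => ?_
    have hθ : 0 ≤ 2 * deriv smoothStep (‖x‖ ^ 2) :=
      mul_nonneg (by norm_num) (deriv_smoothStep_nonneg _)
    have hx : ∀ i, ‖‖x‖⁻¹ * x i‖ ≤ 1 := fun i => by
      rw [norm_mul, norm_inv, norm_norm, inv_mul_eq_div]
      exact div_le_one_of_le₀ (PiLp.norm_apply_le x i) (norm_nonneg _)
    set q := p - coneMap σ (ε • x)
    have h1 : ‖σ • (dirDeriv timeDir f : Spacetime → 𝕜) q - ∑ i, (‖x‖⁻¹ * x i) •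
        (dirDeriv (spaceDir i) f : Spacetime → 𝕜) q‖ ≤ |σ| * Ct + ∑ i, Cs i := by
      refine (norm_sub_le _ _).trans (add_le_add ?_ ((norm_sum_le _ _).trans
        (Finset.sum_le_sum fun i _ => ?_)))
      · rw [norm_smul, Real.norm_eq_abs]
        exact mul_le_mul_of_nonneg_left (hCt q) (abs_nonneg _)
      · rw [norm_smul]
        exact (mul_le_of_le_one_left (norm_nonneg _) (hx i)).trans (hCs i q)
    rw [kirchhoffRescaled, norm_smul, Real.norm_of_nonneg hθ, mul_assoc _ _ C, ← mul_add]
    refine mul_le_mul_of_nonneg_left ((norm_add_le _ _).trans (add_le_add ?_ ?_)) hθ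
    · rw [norm_smul, Real.norm_of_nonneg hε.le]
      exact (mul_le_of_le_one_left (norm_nonneg _) hε1.le).trans h1
    · rw [norm_smul, norm_inv, norm_norm]
      exact mul_le_mul_of_nonneg_left (hC q) (by positivity)
  · refine Eventually.of_forall fun x => Tendsto.mono_left ?_ nhdsWithin_le_nhds
    have hcont : ∀ g : smooth 𝕜, Continuous fun ε : ℝ =>
        (g : Spacetime → 𝕜) (p - coneMap σ (ε • x)) := fun g =>
      (continuous_smooth g).comp (continuous_const.sub ((continuous_coneMap σ).comp
        (continuous_id.smul continuous_const)))
    have : Continuous fun ε : ℝ => kirchhoffRescaled σ ε f p x := by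
      unfold kirchhoffRescaled
      have h0 := hcont f
      have h1 := hcont (DirichletWave.dirDeriv timeDir f)
      have h2 := fun i => hcont (DirichletWave.dirDeriv (spaceDir i) f)
      exact continuous_const.smul ((continuous_id.smul ((continuous_const.smul h1).sub
        (continuous_finsetSum _ fun i _ => continuous_const.smul (h2 i)))).add
          (continuous_const.smul h0))
    convert this.tendsto 0 using 2
    have h0 : coneMap σ 0 = 0 := by ext <;> simp [coneMap]
    simp [kirchhoffRescaled, h0]

/-- Kirchhoff's formula: a compactly supported function is recovered from its image under the wave
operator. -/
theorem conePotential_waveOp {σ : ℝ} (hσ : |σ| = 1) {f : smooth 𝕜}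
    (hc : HasCompactSupport (f : Spacetime → 𝕜)) (p : Spacetime) :
    conePotential σ (waveOp f : Spacetime → 𝕜) p = -(kirchhoffConst • (f : Spacetime → 𝕜) p) := by
  have hcP := HasCompactSupport.waveOp hc
  have hi : Integrable fun y : EuclideanSpace ℝ (Fin 3) =>
      ‖y‖⁻¹ • (waveOp f : Spacetime → 𝕜) (p - coneMap σ y) := by
    obtain ⟨R, hR⟩ := exists_radius_notMem_tsupport σ hcP p
    obtain ⟨C, hC⟩ := (continuous_smooth (waveOp f)).bounded_above_of_compact_support hcP
    have : IntegrableOn (fun y : EuclideanSpace ℝ (Fin 3) =>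
        ‖y‖⁻¹ • (waveOp f : Spacetime → 𝕜) (p - coneMap σ y)) (Metric.ball 0 (R + 1)) := by
      refine Integrable.mono' ((integrableOn_inv_norm_ball (R + 1)).mul_const C) ?_
        (Eventually.of_forall fun y => ?_)
      · exact (measurable_norm.inv).aestronglyMeasurable.smul ((continuous_smooth _).comp
          (continuous_const.sub (continuous_coneMap σ))).aestronglyMeasurable
      · rw [norm_smul, norm_inv, norm_norm]
        exact mul_le_mul_of_nonneg_left (hC _) (by positivity)
    rwa [integrableOn_iff_integrable_of_support_subset fun y hy => ?_] at this
    by_contra h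
    refine hy ?_
    beta_reduce
    rw [image_eq_zero_of_notMem_tsupport (hR y fun h' => h ?_), smul_zero]
    exact Metric.closedBall_subset_ball (by linarith) h'
  have h1 : conePotential σ (waveOp f : Spacetime → 𝕜) p =
      ∫ y, ‖y‖⁻¹ • (waveOp f : Spacetime → 𝕜) (p - coneMap σ y) :=
    integral_coneMeasure σ (f := fun q => (waveOp f : Spacetime → 𝕜) (p - q))
      ((continuous_smooth _).comp (continuous_const.sub continuous_id))
  rw [h1]
  refine tendsto_nhds_unique (f := fun ε : ℝ => ∫ y, (smoothStep (‖y‖ ^ 2 / ε ^ 2) * ‖y‖⁻¹) •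
    (waveOp f : Spacetime → 𝕜) (p - coneMap σ y)) (l := 𝓝[>] 0) ?_ ?_
  · refine tendsto_integral_filter_of_dominated_convergence _ ?_ ?_ hi.norm ?_
    · refine Eventually.of_forall fun ε => ?_
      exact ((continuous_comp_norm_sq_mul_inv contDiff_smoothStep.continuous
        (fun s hs => smoothStep_of_le hs.le) ε).smul
        ((continuous_smooth _).comp
          (continuous_const.sub (continuous_coneMap σ)))).aestronglyMeasurable
    · refine Eventually.of_forall fun ε => Eventually.of_forall fun y => ?_
      rw [mul_smul, norm_smul]
      refine mul_le_of_le_one_left (norm_nonneg _) ?_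
      rw [smoothStep, Real.norm_of_nonneg (Real.smoothTransition.nonneg _)]
      exact Real.smoothTransition.le_one _
    · refine Eventually.of_forall fun y => ?_
      by_cases hy : y = 0
      · simp [hy]
      have hy0 : 0 < ‖y‖ := norm_pos_iff.2 hy
      refine tendsto_const_nhds.congr' ?_
      -- The cutoff is `1` at `y` as soon as `2 ε² ≤ |y|²`.
      have : ∀ᶠ ε in 𝓝 (0 : ℝ), 2 * ε ^ 2 < ‖y‖ ^ 2 :=
        ((by fun_prop : Continuous fun ε : ℝ => 2 * ε ^ 2).tendsto 0).eventually_lt_const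
          (by simpa using pow_pos hy0 2)
      filter_upwards [self_mem_nhdsWithin, nhdsWithin_le_nhds this] with ε (hε : 0 < ε) hε'
      rw [smoothStep_of_ge ((le_div_iff₀ (by positivity)).2 hε'.le), one_mul]
  · simp only [integral_smoothStep_smul_waveOp hσ _ hc p]
    exact (tendsto_integral_kirchhoffBoundary σ hc p).neg

/-- Kirchhoff's formula for functions of half compact support. -/
theorem conePotential_waveOp_of_isHalfCompact {σ : ℝ} (hσ : |σ| = 1) {f : smooth 𝕜}
    (hf : IsHalfCompact σ (tsupport (f : Spacetime → 𝕜))) (p : Spacetime) :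
    conePotential σ (waveOp f : Spacetime → 𝕜) p = -(kirchhoffConst • (f : Spacetime → 𝕜) p) := by
  obtain ⟨g, hg, hfg⟩ := exists_compact_localization hf (isCompact_singleton (x := p))
  rw [(hfg p (subset_cone _ _ rfl)).self_of_nhds, ← conePotential_waveOp hσ hg p]
  exact conePotential_eq_of_eqOn hσ fun q hq => (waveOp_eventuallyEq (hfg q hq)).self_of_nhds

/-! ### The fundamental solutions -/

/-- The retarded (`σ = 1`) or advanced (`σ = -1`) solution of `P u = f`. -/
noncomputable def potential {σ : ℝ} (hσ : |σ| = 1) (f : smooth 𝕜)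
    (hf : IsHalfCompact σ (tsupport (f : Spacetime → 𝕜))) : smooth 𝕜 :=
  (-(kirchhoffConst : 𝕜)⁻¹) • smoothConePotential hσ f hf

theorem potential_waveOp {σ : ℝ} (hσ : |σ| = 1) (f : smooth 𝕜)
    (hf : IsHalfCompact σ (tsupport (f : Spacetime → 𝕜))) :
    potential hσ (waveOp f) hf.waveOp = f := by
  ext p
  change -(kirchhoffConst : 𝕜)⁻¹ * conePotential σ (waveOp f : Spacetime → 𝕜) p = _
  have h0 : (kirchhoffConst : 𝕜) ≠ 0 := by exact_mod_cast kirchhoffConst_pos.ne'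
  rw [conePotential_waveOp_of_isHalfCompact hσ hf, RCLike.real_smul_eq_coe_mul]
  field_simp

theorem waveOp_potential {σ : ℝ} (hσ : |σ| = 1) (f : smooth 𝕜)
    (hf : IsHalfCompact σ (tsupport (f : Spacetime → 𝕜))) :
    waveOp (potential hσ f hf) = f := by
  rw [potential, map_smul, waveOp_smoothConePotential]
  exact potential_waveOp hσ f hf

theorem tsupport_potential_subset {σ : ℝ} (hσ : |σ| = 1) (f : smooth 𝕜)
    (hf : IsHalfCompact σ (tsupport (f : Spacetime → 𝕜))) :
    tsupport (potential hσ f hf : Spacetime → 𝕜) ⊆ cone σ (tsupport (f : Spacetime → 𝕜)) :=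
  (closure_mono (Function.support_const_smul_subset _ _)).trans
    (tsupport_conePotential_subset hσ hf)

/-- A function of half compact support is determined by its image under the wave operator. -/
theorem eq_of_waveOp_eq {σ : ℝ} (hσ : |σ| = 1) {u v : smooth 𝕜}
    (hu : IsHalfCompact σ (tsupport (u : Spacetime → 𝕜)))
    (hv : IsHalfCompact σ (tsupport (v : Spacetime → 𝕜))) (h : waveOp u = waveOp v) : u = v := by
  have hu' := potential_waveOp hσ u hu
  have hv' := potential_waveOp hσ v hv
  simp only [h] at hu'
  exact hu'.symm.trans hv'

theorem IsTimelikeCompact.isHalfCompact {σ : ℝ} (hσ : |σ| = 1) {A : Set Spacetime}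
    (hA : IsTimelikeCompact A) : IsHalfCompact σ A := by
  rcases (abs_eq zero_le_one).1 hσ with rfl | rfl
  exacts [(isTimelikeCompact_iff.1 hA).1, (isTimelikeCompact_iff.1 hA).2]

theorem isHalfCompact_smoothTC {σ : ℝ} (hσ : |σ| = 1) (α : smoothTC 𝕜) :
    IsHalfCompact σ (tsupport ((α : smooth 𝕜) : Spacetime → 𝕜)) :=
  IsTimelikeCompact.isHalfCompact hσ α.2

/-- The retarded (`σ = 1`) and advanced (`σ = -1`) fundamental solutions, treated at once: an
operator solving the wave equation with the support in the future or past of the source. -/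
structure IsGreen (σ : ℝ) (E : smoothTC 𝕜 →ₗ[𝕜] smooth 𝕜) : Prop where
  wave_apply : ∀ α : smoothTC 𝕜, waveOp (E α) = α
  supp : ∀ α : smoothTC 𝕜, tsupport (E α : Spacetime → 𝕜) ⊆
    cone σ (tsupport ((α : smooth 𝕜) : Spacetime → 𝕜))

namespace IsGreen

variable {σ : ℝ} {E : smoothTC 𝕜 →ₗ[𝕜] smooth 𝕜}

theorem isHalfCompact (hσ : |σ| = 1) (hE : IsGreen σ E) (α : smoothTC 𝕜) :
    IsHalfCompact σ (tsupport (E α : Spacetime → 𝕜)) :=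
  ((isHalfCompact_smoothTC hσ α).cone hσ).mono (isClosed_tsupport _) (hE.supp α)

theorem apply_eq (hσ : |σ| = 1) (hE : IsGreen σ E) {α : smoothTC 𝕜} {u : smooth 𝕜}
    (hu : IsHalfCompact σ (tsupport (u : Spacetime → 𝕜))) (h : waveOp u = α) : E α = u :=
  eq_of_waveOp_eq hσ (hE.isHalfCompact hσ α) hu ((hE.wave_apply α).trans h.symm)

theorem apply_wave (hσ : |σ| = 1) (hE : IsGreen σ E) (α : smoothTC 𝕜) : E (waveOpTC α) = α :=
  hE.apply_eq hσ (isHalfCompact_smoothTC hσ α) rfl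

theorem eq (hσ : |σ| = 1) (hE : IsGreen σ E) {E' : smoothTC 𝕜 →ₗ[𝕜] smooth 𝕜}
    (hE' : IsGreen σ E') : E = E' :=
  LinearMap.ext fun α => hE.apply_eq hσ (hE'.isHalfCompact hσ α) (hE'.wave_apply α)

end IsGreen

variable (𝕜) in
/-- The fundamental solution given by the potentials. -/
noncomputable def greenOp {σ : ℝ} (hσ : |σ| = 1) : smoothTC 𝕜 →ₗ[𝕜] smooth 𝕜 where
  toFun α := potential hσ α (isHalfCompact_smoothTC hσ α)
  map_add' α β := by
    have hab := isHalfCompact_smoothTC hσ (α + β)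
    refine eq_of_waveOp_eq hσ
      (((isHalfCompact_smoothTC hσ (α + β)).cone hσ).mono (isClosed_tsupport _)
        (tsupport_potential_subset hσ _ _))
      (IsHalfCompact.mono (IsHalfCompact.union
        (((isHalfCompact_smoothTC hσ α).cone hσ).mono (isClosed_tsupport _)
          (tsupport_potential_subset hσ _ _))
        (((isHalfCompact_smoothTC hσ β).cone hσ).mono (isClosed_tsupport _)
          (tsupport_potential_subset hσ _ _))) (isClosed_tsupport _) (tsupport_add _ _)) ?_
    rw [map_add, waveOp_potential, waveOp_potential, waveOp_potential]
    rfl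
  map_smul' c α := by
    refine eq_of_waveOp_eq hσ
      (((isHalfCompact_smoothTC hσ (c • α)).cone hσ).mono (isClosed_tsupport _)
        (tsupport_potential_subset hσ _ _))
      ((((isHalfCompact_smoothTC hσ α).cone hσ).mono (isClosed_tsupport _)
          (tsupport_potential_subset hσ _ _)).mono (isClosed_tsupport _)
        (closure_mono (Function.support_const_smul_subset c _))) ?_
    rw [map_smul, waveOp_potential, waveOp_potential]
    rfl

theorem isGreen_greenOp {σ : ℝ} (hσ : |σ| = 1) : IsGreen σ (greenOp 𝕜 hσ) :=
  ⟨fun _ => waveOp_potential hσ _ _, fun _ => tsupport_potential_subset hσ _ _⟩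

theorem isRetarded_iff {E : smoothTC 𝕜 →ₗ[𝕜] smooth 𝕜} : IsRetarded E ↔ IsGreen 1 E :=
  ⟨fun h => ⟨h.wave_apply, fun α => by rw [cone_one]; exact h.supp α⟩,
    fun h => ⟨h.wave_apply, h.apply_wave abs_one, fun α => by rw [← cone_one]; exact h.supp α⟩⟩

theorem abs_neg_one_eq : |(-1 : ℝ)| = 1 := by simp

theorem isAdvanced_iff {E : smoothTC 𝕜 →ₗ[𝕜] smooth 𝕜} : IsAdvanced E ↔ IsGreen (-1) E :=
  ⟨fun h => ⟨h.wave_apply, fun α => by rw [cone_neg_one]; exact h.supp α⟩,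
    fun h => ⟨h.wave_apply, h.apply_wave abs_neg_one_eq,
      fun α => by rw [← cone_neg_one]; exact h.supp α⟩⟩

variable (𝕜) in
theorem existsUnique_isAdvanced : ∃! E : smoothTC 𝕜 →ₗ[𝕜] smooth 𝕜, IsAdvanced E :=
  ⟨greenOp 𝕜 abs_neg_one_eq, isAdvanced_iff.2 (isGreen_greenOp _), fun _ h =>
    (isAdvanced_iff.1 h).eq abs_neg_one_eq (isGreen_greenOp _)⟩

variable (𝕜) in
theorem existsUnique_isRetarded : ∃! E : smoothTC 𝕜 →ₗ[𝕜] smooth 𝕜, IsRetarded E :=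
  ⟨greenOp 𝕜 abs_one, isRetarded_iff.2 (isGreen_greenOp _), fun _ h =>
    (isRetarded_iff.1 h).eq abs_one (isGreen_greenOp _)⟩

/-! ### Reflections -/

@[simp]
theorem reflect_reflect (c : ℝ) (p : Spacetime) : reflect c (reflect c p) = p := by
  refine Prod.ext rfl ?_
  ext j
  fin_cases j <;> simp [reflect]

theorem contDiff_reflect (c : ℝ) : ContDiff ℝ ∞ (reflect c) := by
  refine contDiff_fst.prodMk (contDiff_euclidean.2 fun i => ?_)
  fin_cases i
  · change ContDiff ℝ ∞ fun p : Spacetime => p.2 0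
    fun_prop
  · change ContDiff ℝ ∞ fun p : Spacetime => p.2 1
    fun_prop
  · change ContDiff ℝ ∞ fun p : Spacetime => 2 * c - p.2 2
    fun_prop

theorem continuous_reflect (c : ℝ) : Continuous (reflect c) := (contDiff_reflect c).continuous

theorem reflect_timeDir (c : ℝ) (p : Spacetime) (s : ℝ) :
    reflect c (p + s • timeDir) = reflect c p + ((1 : ℝ) * s) • timeDir := by
  refine Prod.ext ?_ ?_
  · simp [reflect, timeDir]
  · ext j
    fin_cases j <;> simp [reflect, timeDir]

theorem reflect_spaceDir (c : ℝ) (i : Fin 3) (p : Spacetime) (s : ℝ) :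
    reflect c (p + s • spaceDir i) =
      reflect c p + ((if i = 2 then -1 else 1 : ℝ) * s) • spaceDir i := by
  refine Prod.ext ?_ ?_
  · split_ifs <;> simp [reflect, spaceDir]
  · ext j
    fin_cases i <;> fin_cases j <;> (simp [reflect, spaceDir]; try ring)

theorem norm_reflect_sub (c : ℝ) (p q : Spacetime) :
    ‖(reflect c q).2 - (reflect c p).2‖ = ‖q.2 - p.2‖ := by
  rw [EuclideanSpace.norm_eq, EuclideanSpace.norm_eq]
  congr 1
  simp only [Fin.sum_univ_three]
  simp [reflect]
  ring

/-- The pullback of a smooth function by a reflection. -/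
def reflectPullback (c : ℝ) (f : smooth 𝕜) : smooth 𝕜 :=
  ⟨fun p => (f : Spacetime → 𝕜) (reflect c p), (contDiff_smooth f).comp (contDiff_reflect c)⟩

theorem dirDeriv_reflectPullback {c ε : ℝ} {v : Spacetime}
    (hv : ∀ (p : Spacetime) (s : ℝ), reflect c (p + s • v) = reflect c p + (ε * s) • v)
    (f : smooth 𝕜) :
    dirDeriv v (reflectPullback c f) = (ε : 𝕜) • reflectPullback c (dirDeriv v f) := by
  ext p
  have h1 : HasDerivAt (fun s : ℝ => (reflectPullback c f : Spacetime → 𝕜) (p + s • v))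
      ((dirDeriv v (reflectPullback c f) : Spacetime → 𝕜) p) 0 :=
    (smooth_differentiable (reflectPullback c f) p).hasFDerivAt.hasLineDerivAt v
  have h2 : HasDerivAt (fun s : ℝ => (f : Spacetime → 𝕜) (reflect c p + s • v))
      ((dirDeriv v f : Spacetime → 𝕜) (reflect c p)) (ε * 0) := by
    rw [mul_zero]
    exact (smooth_differentiable f (reflect c p)).hasFDerivAt.hasLineDerivAt v
  have h3 := h2.scomp (0 : ℝ) ((hasDerivAt_id (0 : ℝ)).const_mul ε)
  have h4 : (fun s : ℝ => (reflectPullback c f : Spacetime → 𝕜) (p + s • v)) =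
      (fun s : ℝ => (f : Spacetime → 𝕜) (reflect c p + s • v)) ∘ fun s => ε * s := by
    funext s
    exact congrArg (f : Spacetime → 𝕜) (hv p s)
  rw [h4] at h1
  refine (h1.unique h3).trans ?_
  rw [mul_one, RCLike.real_smul_eq_coe_mul]
  rfl

theorem waveOp_reflectPullback (c : ℝ) (f : smooth 𝕜) :
    waveOp (reflectPullback c f) = reflectPullback c (waveOp f) := by
  have key : ∀ (v : Spacetime) (ε : ℝ), ε * ε = 1 →
      (∀ (p : Spacetime) (s : ℝ), reflect c (p + s • v) = reflect c p + (ε * s) • v) →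
      dirDeriv v (dirDeriv v (reflectPullback c f)) =
        reflectPullback c (dirDeriv v (dirDeriv v f)) := by
    intro v ε hε hv
    rw [dirDeriv_reflectPullback hv, map_smul, dirDeriv_reflectPullback hv, smul_smul,
      ← RCLike.ofReal_mul, hε, RCLike.ofReal_one, one_smul]
  ext p
  rw [waveOp_apply, key timeDir 1 (by norm_num) (reflect_timeDir c), Finset.sum_congr rfl fun i _ =>
    by rw [key (spaceDir i) _ (by split_ifs <;> norm_num) (reflect_spaceDir c i)]]
  exact (waveOp_apply f (reflect c p)).symm

theorem IsHalfCompact.preimage_reflect {σ : ℝ} {A : Set Spacetime} (hA : IsHalfCompact σ A) (c : ℝ) :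
    IsHalfCompact σ (reflect c ⁻¹' A) := by
  refine ⟨hA.1.preimage (continuous_reflect c), fun K hK => ?_⟩
  refine ((hA.2 _ (hK.image (continuous_reflect c))).image (continuous_reflect c)).of_isClosed_subset
    ((hA.1.preimage (continuous_reflect c)).inter (isClosed_cone_of_isCompact _ hK)) ?_
  rintro q ⟨hq, k, hk, hkq⟩
  exact ⟨reflect c q, ⟨hq, reflect c k, ⟨k, hk, rfl⟩, by rwa [norm_reflect_sub]⟩,
    reflect_reflect c q⟩

theorem tsupport_reflectPullback_subset (c : ℝ) (f : smooth 𝕜) :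
    tsupport (reflectPullback c f : Spacetime → 𝕜) ⊆
      reflect c ⁻¹' tsupport (f : Spacetime → 𝕜) :=
  closure_minimal (fun _ hp => subset_tsupport (f : Spacetime → 𝕜) hp)
    ((isClosed_tsupport _).preimage (continuous_reflect c))

theorem mem_oddAbout_iff {c : ℝ} {f : smooth 𝕜} : f ∈ oddAbout 𝕜 c ↔ -reflectPullback c f = f :=
  ⟨fun h => Subtype.ext (funext fun p => (h p).symm),
    fun h p => (congrArg (fun g : smooth 𝕜 => (g : Spacetime → 𝕜) p) h).symm⟩

/-- The fundamental solutions preserve odd functions. -/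
theorem IsGreen.mem_oddAbout {σ : ℝ} (hσ : |σ| = 1) {E : smoothTC 𝕜 →ₗ[𝕜] smooth 𝕜}
    (hE : IsGreen σ E) {c : ℝ} {α : smoothTC 𝕜} (hα : (α : smooth 𝕜) ∈ oddAbout 𝕜 c) :
    E α ∈ oddAbout 𝕜 c := by
  refine mem_oddAbout_iff.2 (hE.apply_eq hσ ?_ ?_).symm
  · refine ((hE.isHalfCompact hσ α).preimage_reflect c).mono (isClosed_tsupport _) ?_
    have : tsupport ((-reflectPullback c (E α) : smooth 𝕜) : Spacetime → 𝕜) =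
        tsupport (reflectPullback c (E α) : Spacetime → 𝕜) := by
      simp [tsupport]
    rw [this]
    exact tsupport_reflectPullback_subset c _
  · rw [map_neg, waveOp_reflectPullback, hE.wave_apply]
    exact mem_oddAbout_iff.1 hα

/-! ### The reflection principle -/

/-- The extension of a function from `{z ≥ 0}` by `φ(x, z) = δ φ(x, -z)`: even for `δ = 1` and odd
for `δ = -1`. -/
noncomputable def reflectExt (δ : ℝ) (φ : Spacetime → 𝕜) (p : Spacetime) : 𝕜 :=
  if 0 ≤ zCoord p then φ p else δ • φ (reflect 0 p)

@[simp]
theorem zCoord_reflect (c : ℝ) (p : Spacetime) : zCoord (reflect c p) = 2 * c - zCoord p := by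
  simp [zCoord, reflect]

theorem reflect_eq_self {c : ℝ} {p : Spacetime} (hp : zCoord p = c) : reflect c p = p := by
  refine Prod.ext rfl ?_
  have hp' : p.2 2 = c := hp
  ext j
  fin_cases j
  · simp [reflect]
  · simp [reflect]
  · simp [reflect, hp', two_mul]

section Within

variable {Ω : Set Spacetime}

theorem dirDerivWithin_congr {v : Spacetime} {φ ψ : Spacetime → 𝕜} (h : Set.EqOn φ ψ Ω)
    {p : Spacetime} (hp : p ∈ Ω) : dirDerivWithin Ω v φ p = dirDerivWithin Ω v ψ p := by
  rw [dirDerivWithin, dirDerivWithin, fderivWithin_congr h (h hp)]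

theorem dirDerivWithin_dirDerivWithin (hΩ : UniqueDiffOn ℝ Ω) {φ : Spacetime → 𝕜}
    (hφ : ContDiffOn ℝ ∞ φ Ω) (v w : Spacetime) {p : Spacetime} (hp : p ∈ Ω) :
    dirDerivWithin Ω v (dirDerivWithin Ω w φ) p =
      fderivWithin ℝ (fderivWithin ℝ φ Ω) Ω p v w := by
  have hd : DifferentiableWithinAt ℝ (fderivWithin ℝ φ Ω) Ω p :=
    (hφ.fderivWithin (m := ∞) hΩ (by simp)).differentiableOn (by simp) p hp
  have := (hd.hasFDerivWithinAt.clm_apply (hasFDerivWithinAt_const w p Ω)).fderivWithin (hΩ p hp)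
  refine (congrArg (fun L : Spacetime →L[ℝ] 𝕜 => L v) this).trans ?_
  simp

theorem dirDerivWithin_comm (hΩ : UniqueDiffOn ℝ Ω) (hcl : Ω ⊆ closure (interior Ω))
    {φ : Spacetime → 𝕜} (hφ : ContDiffOn ℝ ∞ φ Ω) (v w : Spacetime) {p : Spacetime} (hp : p ∈ Ω) :
    dirDerivWithin Ω v (dirDerivWithin Ω w φ) p = dirDerivWithin Ω w (dirDerivWithin Ω v φ) p := by
  rw [dirDerivWithin_dirDerivWithin hΩ hφ v w hp, dirDerivWithin_dirDerivWithin hΩ hφ w v hp]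
  exact (hφ p hp).isSymmSndFDerivWithinAt
    (by rw [minSmoothness_of_isRCLikeNormedField]; exact WithTop.coe_le_coe.2 le_top) hΩ
    (hcl hp) hp v w

theorem waveOpWithin_dirDerivWithin (hΩ : UniqueDiffOn ℝ Ω) (hcl : Ω ⊆ closure (interior Ω))
    {φ : Spacetime → 𝕜} (hφ : ContDiffOn ℝ ∞ φ Ω) (hw : ∀ p ∈ Ω, waveOpWithin Ω φ p = 0)
    (v : Spacetime) {p : Spacetime} (hp : p ∈ Ω) :
    waveOpWithin Ω (dirDerivWithin Ω v φ) p = 0 := by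
  have hs := fun w => dirDerivWithin_contDiffOn hΩ w hφ
  have hss := fun w => dirDerivWithin_contDiffOn hΩ w (hs w)
  have key : ∀ w, dirDerivWithin Ω w (dirDerivWithin Ω w (dirDerivWithin Ω v φ)) p =
      dirDerivWithin Ω v (dirDerivWithin Ω w (dirDerivWithin Ω w φ)) p := fun w => by
    rw [dirDerivWithin_congr (fun q hq => dirDerivWithin_comm hΩ hcl hφ w v hq) hp,
      dirDerivWithin_comm hΩ hcl (hs w) w v hp]
  have hd := fun w => ((hss w).differentiableOn (by simp) p hp).hasFDerivWithinAt
  have h1 : HasFDerivWithinAt (waveOpWithin Ω φ)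
      (-fderivWithin ℝ (dirDerivWithin Ω timeDir (dirDerivWithin Ω timeDir φ)) Ω p +
        ∑ i, fderivWithin ℝ (dirDerivWithin Ω (spaceDir i) (dirDerivWithin Ω (spaceDir i) φ)) Ω p)
      Ω p :=
    (hd timeDir).neg.add (HasFDerivWithinAt.fun_sum fun i _ => hd (spaceDir i))
  have h2 : HasFDerivWithinAt (waveOpWithin Ω φ) (0 : Spacetime →L[ℝ] 𝕜) Ω p :=
    (hasFDerivWithinAt_const (0 : 𝕜) p Ω).congr hw (hw p hp)
  have h3 := congrArg (fun L : Spacetime →L[ℝ] 𝕜 => L v) ((hΩ p hp).eq h1 h2)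
  rw [waveOpWithin]
  simp only [key]
  simpa [dirDerivWithin] using h3

/-- A relation `φ = c φ` on the boundary may be differentiated in tangential directions. -/
theorem dirDerivWithin_eq_smul_of_boundary {U : Set Spacetime} (hU : IsOpen U)
    (hΩU : Ω = halfSpace ∩ U) {φ : Spacetime → 𝕜} (hφ : ContDiffOn ℝ ∞ φ Ω) {c : ℝ}
    (h : ∀ p ∈ U, zCoord p = 0 → φ p = c • φ p) {v : Spacetime} (hv : zCoord v = 0) :
    ∀ p ∈ U, zCoord p = 0 → dirDerivWithin Ω v φ p = c • dirDerivWithin Ω v φ p := by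
  intro p hp hz
  have hz' : ∀ s : ℝ, zCoord (p + s • v) = 0 := fun s => by
    have h1 : p.2 2 = 0 := hz
    have h2 : v.2 2 = 0 := hv
    simp [zCoord, h1, h2]
  have hpΩ : p ∈ Ω := by rw [hΩU]; exact ⟨hz.ge, hp⟩
  let S : Set ℝ := {s | p + s • v ∈ U}
  have hS : S ∈ 𝓝 (0 : ℝ) := (hU.preimage (by fun_prop)).mem_nhds (by simpa using hp)
  have hl : HasDerivWithinAt (fun s : ℝ => p + s • v) v S 0 := by
    have := ((hasDerivAt_id (0 : ℝ)).smul_const v).const_add p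
    rw [one_smul] at this
    exact this.hasDerivWithinAt
  have hd : HasFDerivWithinAt φ (fderivWithin ℝ φ Ω p) Ω (p + (0 : ℝ) • v) := by
    rw [zero_smul, add_zero]
    exact (hφ.differentiableOn (by simp) p hpΩ).hasFDerivWithinAt
  have h1 := ((hd.comp_hasDerivWithinAt (0 : ℝ) hl fun s hs => by
    rw [hΩU]; exact ⟨(hz' s).ge, hs⟩).hasDerivAt hS)
  have h2 := h1.const_smul c
  have : (fun s : ℝ => φ (p + s • v)) =ᶠ[𝓝 0] fun s => c • φ (p + s • v) := by
    filter_upwards [hS] with s hs using h _ hs (hz' s)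
  exact (h1.congr_of_eventuallyEq this.symm).unique h2 |>.symm ▸ rfl

end Within

theorem subset_closure_interior_halfSpace_inter {U : Set Spacetime} (hU : IsOpen U) :
    halfSpace ∩ U ⊆ closure (interior (halfSpace ∩ U)) := by
  rintro p ⟨hp, hpU⟩
  have hsub : {q | 0 < zCoord q} ∩ U ⊆ interior (halfSpace ∩ U) :=
    interior_maximal (Set.inter_subset_inter_left _ fun q (hq : 0 < zCoord q) => hq.le)
      ((isOpen_lt continuous_const continuous_zCoord).inter hU)
  refine closure_mono hsub ?_
  have hc : Tendsto (fun s : ℝ => p + s • spaceDir 2) (𝓝[>] 0) (𝓝 p) := by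
    have : Continuous fun s : ℝ => p + s • spaceDir 2 := by fun_prop
    simpa using (this.tendsto 0).mono_left nhdsWithin_le_nhds
  refine mem_closure_of_tendsto hc ?_
  filter_upwards [self_mem_nhdsWithin, hc.eventually (hU.mem_nhds hpU)] with s (hs : 0 < s) hsU
  have hp' : 0 ≤ p.2 2 := hp
  refine ⟨?_, hsU⟩
  have : 0 < p.2 2 + s := by linarith
  simpa [zCoord, spaceDir] using this

/-- Smooth solutions of the wave equation on `U ∩ {z ≥ 0}` with the Dirichlet (`δ = -1`) or the
Neumann (`δ = 1`) boundary condition. The condition `a = δ a` says that `a` vanishes if `δ = -1`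
and imposes nothing if `δ = 1`. -/
structure IsReflectable (U : Set Spacetime) (δ : ℝ) (φ : Spacetime → 𝕜) : Prop where
  contDiffOn : ContDiffOn ℝ ∞ φ (halfSpace ∩ U)
  wave : ∀ p ∈ halfSpace ∩ U, waveOpWithin (halfSpace ∩ U) φ p = 0
  value : ∀ p ∈ U, zCoord p = 0 → φ p = δ • φ p
  normal : ∀ p ∈ U, zCoord p = 0 →
    dirDerivWithin (halfSpace ∩ U) (spaceDir 2) φ p =
      (-δ) • dirDerivWithin (halfSpace ∩ U) (spaceDir 2) φ p

namespace IsReflectable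

variable {U : Set Spacetime} {δ : ℝ} {φ : Spacetime → 𝕜}

theorem tangential (hU : IsOpen U) (h : IsReflectable U δ φ) {v : Spacetime} (hv : zCoord v = 0) :
    IsReflectable U δ (dirDerivWithin (halfSpace ∩ U) v φ) := by
  have hΩ := uniqueDiffOn_halfSpace.inter hU
  have hcl := subset_closure_interior_halfSpace_inter hU
  refine ⟨dirDerivWithin_contDiffOn hΩ v h.contDiffOn,
    fun p hp => waveOpWithin_dirDerivWithin hΩ hcl h.contDiffOn h.wave v hp,
    dirDerivWithin_eq_smul_of_boundary hU rfl h.contDiffOn h.value hv, fun p hp hz => ?_⟩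
  rw [dirDerivWithin_comm hΩ hcl h.contDiffOn _ _ ⟨hz.ge, hp⟩]
  exact dirDerivWithin_eq_smul_of_boundary hU rfl (dirDerivWithin_contDiffOn hΩ _ h.contDiffOn)
    h.normal hv p hp hz

/-- The normal derivative exchanges the boundary conditions; by the wave equation the second normal
derivative is a combination of second tangential derivatives. -/
theorem normalDeriv (hU : IsOpen U) (h : IsReflectable U δ φ) :
    IsReflectable U (-δ) (dirDerivWithin (halfSpace ∩ U) (spaceDir 2) φ) := by
  have hΩ := uniqueDiffOn_halfSpace.inter hU
  have hcl := subset_closure_interior_halfSpace_inter hU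
  refine ⟨dirDerivWithin_contDiffOn hΩ _ h.contDiffOn,
    fun p hp => waveOpWithin_dirDerivWithin hΩ hcl h.contDiffOn h.wave _ hp,
    h.normal, fun p hp hz => ?_⟩
  have ht := ((h.tangential hU (v := timeDir) (by simp [zCoord, timeDir])).tangential hU
    (v := timeDir) (by simp [zCoord, timeDir])).value p hp hz
  have h0 := ((h.tangential hU (v := spaceDir 0) (by simp [zCoord, spaceDir])).tangential hU
    (v := spaceDir 0) (by simp [zCoord, spaceDir])).value p hp hz
  have h1 := ((h.tangential hU (v := spaceDir 1) (by simp [zCoord, spaceDir])).tangential hU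
    (v := spaceDir 1) (by simp [zCoord, spaceDir])).value p hp hz
  have hw := h.wave p ⟨hz.ge, hp⟩
  rw [waveOpWithin, Fin.sum_univ_three] at hw
  have e : dirDerivWithin (halfSpace ∩ U) (spaceDir 2)
      (dirDerivWithin (halfSpace ∩ U) (spaceDir 2) φ) p =
      dirDerivWithin (halfSpace ∩ U) timeDir (dirDerivWithin (halfSpace ∩ U) timeDir φ) p -
      dirDerivWithin (halfSpace ∩ U) (spaceDir 0)
        (dirDerivWithin (halfSpace ∩ U) (spaceDir 0) φ) p -
      dirDerivWithin (halfSpace ∩ U) (spaceDir 1)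
        (dirDerivWithin (halfSpace ∩ U) (spaceDir 1) φ) p := by
    linear_combination hw
  rw [neg_neg, e, smul_sub, smul_sub, ← ht, ← h0, ← h1]

end IsReflectable

theorem fderiv_reflect_apply {ε : ℝ} {v : Spacetime} (c : ℝ)
    (hv : ∀ (p : Spacetime) (s : ℝ), reflect c (p + s • v) = reflect c p + (ε * s) • v)
    (p : Spacetime) : fderiv ℝ (reflect c) p v = ε • v := by
  have h1 : HasDerivAt (fun s : ℝ => reflect c (p + s • v)) (fderiv ℝ (reflect c) p v) 0 :=
    ((contDiff_reflect c).differentiable (by simp) p).hasFDerivAt.hasLineDerivAt v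
  simp only [hv] at h1
  have h2 : HasDerivAt (fun s : ℝ => reflect c p + (ε * s) • v) (ε • v) 0 := by
    have := (((hasDerivAt_id (0 : ℝ)).const_mul ε).smul_const v).const_add (reflect c p)
    rwa [mul_one] at this
  exact h1.unique h2

theorem eq_sum_coord (v : Spacetime) : v = v.1 • timeDir + ∑ i, v.2 i • spaceDir i := by
  refine Prod.ext ?_ ?_
  · simp [timeDir, spaceDir, Fin.sum_univ_three]
  · ext j
    fin_cases j <;> simp [timeDir, spaceDir, Fin.sum_univ_three]

theorem clm_apply_eq_sum (L : Spacetime →L[ℝ] 𝕜) (v : Spacetime) :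
    L v = v.1 • L timeDir + ∑ i, v.2 i • L (spaceDir i) := by
  conv_lhs => rw [eq_sum_coord v]
  simp only [map_add, map_sum, map_smul]

theorem clm_ext_coord {L M : Spacetime →L[ℝ] 𝕜} (ht : L timeDir = M timeDir)
    (hs : ∀ i, L (spaceDir i) = M (spaceDir i)) : L = M := by
  refine ContinuousLinearMap.ext fun v => ?_
  rw [clm_apply_eq_sum L, clm_apply_eq_sum M, ht]
  simp only [hs]

theorem zCoord_spaceDir (i : Fin 3) (hi : i ≠ 2) : zCoord (spaceDir i) = 0 := by
  fin_cases i <;> simp_all [zCoord, spaceDir]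

/-- The extension is differentiable, and its derivatives are the extensions of the derivatives. -/
theorem IsReflectable.hasFDerivAt_reflectExt {U : Set Spacetime} (hU : IsOpen U)
    (hUr : ∀ p ∈ U, reflect 0 p ∈ U) {δ : ℝ} {φ : Spacetime → 𝕜} (h : IsReflectable U δ φ)
    {p : Spacetime} (hp : p ∈ U) :
    HasFDerivAt (reflectExt δ φ)
      (if 0 ≤ zCoord p then fderivWithin ℝ φ (halfSpace ∩ U) p
        else δ • (fderivWithin ℝ φ (halfSpace ∩ U) (reflect 0 p)).comp
          (fderiv ℝ (reflect 0) p)) p := by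
  have hd := fun q hq => (h.contDiffOn.differentiableOn (by simp) q hq).hasFDerivWithinAt
  have hR := ((contDiff_reflect 0).differentiable (by simp) p).hasFDerivAt
  have hpos : 0 ≤ zCoord p → HasFDerivWithinAt (reflectExt δ φ)
      (fderivWithin ℝ φ (halfSpace ∩ U) p) (halfSpace ∩ U) p := fun hz =>
    (hd p ⟨hz, hp⟩).congr (fun q hq => if_pos hq.1) (if_pos hz)
  have hneg_eq : ∀ q ∈ U, zCoord q ≤ 0 → reflectExt δ φ q = δ • φ (reflect 0 q) := by
    intro q hq hz
    rcases hz.lt_or_eq with hz | hz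
    · exact if_neg hz.not_ge
    · rw [reflectExt, if_pos hz.ge, reflect_eq_self hz]
      exact h.value q hq hz
  have hneg : zCoord p ≤ 0 → HasFDerivWithinAt (reflectExt δ φ)
      (δ • (fderivWithin ℝ φ (halfSpace ∩ U) (reflect 0 p)).comp (fderiv ℝ (reflect 0) p))
      ({q | zCoord q ≤ 0} ∩ U) p := fun hz => by
    have hmaps : Set.MapsTo (reflect 0) ({q | zCoord q ≤ 0} ∩ U) (halfSpace ∩ U) := by
      rintro q ⟨hq, hqU⟩
      refine ⟨?_, hUr q hqU⟩
      have hq' : zCoord q ≤ 0 := hq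
      change 0 ≤ zCoord (reflect 0 q)
      rw [zCoord_reflect]; linarith
    exact (((hd _ (hmaps ⟨hz, hp⟩)).comp p hR.hasFDerivWithinAt hmaps).const_smul δ).congr
      (fun q hq => hneg_eq q hq.2 hq.1) (hneg_eq p hp hz)
  rcases lt_trichotomy (zCoord p) 0 with hz | hz | hz
  · rw [if_neg hz.not_ge]
    refine (hneg hz.le).hasFDerivAt (inter_mem ?_ (hU.mem_nhds hp))
    exact mem_of_superset ((isOpen_lt continuous_zCoord continuous_const).mem_nhds hz)
      fun q (hq : zCoord q < 0) => hq.le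
  · rw [if_pos hz.ge]
    have e : δ • (fderivWithin ℝ φ (halfSpace ∩ U) (reflect 0 p)).comp (fderiv ℝ (reflect 0) p) =
        fderivWithin ℝ φ (halfSpace ∩ U) p := by
      rw [reflect_eq_self hz]
      have hv := fun v (hv : zCoord v = 0) => ((h.tangential hU hv).value p hp hz).symm
      refine clm_ext_coord ?_ fun i => ?_
      · have := hv timeDir (by simp [zCoord, timeDir])
        simpa [fderiv_reflect_apply 0 (reflect_timeDir 0), dirDerivWithin] using this
      · have hfd := fderiv_reflect_apply 0 (reflect_spaceDir 0 i) p
        by_cases hi : i = 2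
        · subst hi
          have := (h.normal p hp hz).symm
          simpa [hfd, dirDerivWithin] using this
        · have := hv (spaceDir i) (zCoord_spaceDir i hi)
          simpa [hfd, hi, dirDerivWithin] using this
    have h2 := hneg hz.le
    rw [e] at h2
    refine ((hpos hz.ge).union h2).hasFDerivAt ?_
    filter_upwards [hU.mem_nhds hp] with q hq
    exact (le_total 0 (zCoord q)).imp (fun h => ⟨h, hq⟩) fun h => ⟨h, hq⟩
  · rw [if_pos hz.le]
    refine (hpos hz.le).hasFDerivAt (inter_mem ?_ (hU.mem_nhds hp))
    exact mem_of_superset ((isOpen_lt continuous_const continuous_zCoord).mem_nhds hz)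
      fun q (hq : 0 < zCoord q) => hq.le

theorem IsReflectable.fderiv_reflectExt_apply {U : Set Spacetime} (hU : IsOpen U)
    (hUr : ∀ p ∈ U, reflect 0 p ∈ U) {δ : ℝ} {φ : Spacetime → 𝕜} (h : IsReflectable U δ φ)
    {ε : ℝ} {v : Spacetime}
    (hv : ∀ (p : Spacetime) (s : ℝ), reflect 0 (p + s • v) = reflect 0 p + (ε * s) • v)
    {p : Spacetime} (hp : p ∈ U) :
    fderiv ℝ (reflectExt δ φ) p v =
      reflectExt (δ * ε) (dirDerivWithin (halfSpace ∩ U) v φ) p := by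
  rw [(h.hasFDerivAt_reflectExt hU hUr hp).fderiv, reflectExt]
  split_ifs with hz
  · rfl
  · simp [fderiv_reflect_apply 0 hv, dirDerivWithin, mul_smul]

/-- The reflection principle: the extension is smooth across the boundary. -/
theorem IsReflectable.contDiffOn_reflectExt_nat {U : Set Spacetime} (hU : IsOpen U)
    (hUr : ∀ p ∈ U, reflect 0 p ∈ U) (n : ℕ) : ∀ {δ : ℝ} {φ : Spacetime → 𝕜},
    IsReflectable U δ φ → ContDiffOn ℝ n (reflectExt δ φ) U := by
  induction n with
  | zero =>
    intro δ φ h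
    exact contDiffOn_zero.2 fun p hp =>
      (h.hasFDerivAt_reflectExt hU hUr hp).continuousAt.continuousWithinAt
  | succ n ih =>
    intro δ φ h
    rw [Nat.cast_add_one, contDiffOn_succ_iff_fderiv_of_isOpen hU]
    refine ⟨fun p hp =>
      (h.hasFDerivAt_reflectExt hU hUr hp).differentiableAt.differentiableWithinAt, by simp, ?_⟩
    have ht : ContDiffOn ℝ n (fun p => fderiv ℝ (reflectExt δ φ) p timeDir) U :=
      (ih (h.tangential hU (v := timeDir) (by simp [zCoord, timeDir]))).congr fun p hp => by
        rw [h.fderiv_reflectExt_apply hU hUr (reflect_timeDir 0) hp, mul_one]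
    have hs : ∀ i, ContDiffOn ℝ n (fun p => fderiv ℝ (reflectExt δ φ) p (spaceDir i)) U := by
      intro i
      by_cases hi : i = 2
      · refine (ih (h.normalDeriv hU)).congr fun p hp => ?_
        rw [h.fderiv_reflectExt_apply hU hUr (reflect_spaceDir 0 i) hp, if_pos hi, mul_neg_one, hi]
      · refine (ih (h.tangential hU (zCoord_spaceDir i hi))).congr fun p hp => ?_
        rw [h.fderiv_reflectExt_apply hU hUr (reflect_spaceDir 0 i) hp, if_neg hi, mul_one]
    refine contDiffOn_clm_apply.2 fun v => ?_
    simp only [clm_apply_eq_sum _ v]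
    exact (ht.const_smul _).add (ContDiffOn.sum fun i _ => (hs i).const_smul _)

theorem IsReflectable.contDiffOn_reflectExt {U : Set Spacetime} (hU : IsOpen U)
    (hUr : ∀ p ∈ U, reflect 0 p ∈ U) {δ : ℝ} {φ : Spacetime → 𝕜} (h : IsReflectable U δ φ) :
    ContDiffOn ℝ ∞ (reflectExt δ φ) U :=
  contDiffOn_infty.2 fun n => h.contDiffOn_reflectExt_nat hU hUr n

/-! ### Extension of Dirichlet solutions -/

theorem isOpenMap_zCoord : IsOpenMap zCoord := by
  let L : Spacetime →L[ℝ] ℝ :=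
    (EuclideanSpace.proj (2 : Fin 3)).comp (ContinuousLinearMap.snd ℝ ℝ (EuclideanSpace ℝ (Fin 3)))
  have : Function.Surjective L := fun a => ⟨a • spaceDir 2, by simp [L, spaceDir]⟩
  exact L.isOpenMap this

theorem mem_frontier_halfSpace {p : Spacetime} : p ∈ frontier halfSpace ↔ zCoord p = 0 := by
  have := isOpenMap_zCoord.preimage_frontier_eq_frontier_preimage continuous_zCoord (Set.Ici 0)
  rw [frontier_Ici] at this
  exact (Set.ext_iff.1 this p).symm

theorem mem_frontier_slab {d : ℝ} (hd : 0 < d) {p : Spacetime} :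
    p ∈ frontier (slab d) ↔ zCoord p = 0 ∨ zCoord p = d := by
  have := isOpenMap_zCoord.preimage_frontier_eq_frontier_preimage continuous_zCoord (Set.Icc 0 d)
  rw [frontier_Icc hd.le] at this
  exact (Set.ext_iff.1 this p).symm

theorem zeroExtend_apply {Ω : Set Spacetime} (φ : Ω → 𝕜) (p : Ω) :
    zeroExtend φ (p : Spacetime) = φ p :=
  Subtype.val_injective.extend_apply φ 0 p

theorem reflectExt_neg_one_mem_oddAbout {φ : Spacetime → 𝕜} (h0 : ∀ p, zCoord p = 0 → φ p = 0)
    (p : Spacetime) : reflectExt (-1) φ p = -reflectExt (-1) φ (reflect 0 p) := by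
  have hz : zCoord (reflect 0 p) = -zCoord p := by simp
  rcases lt_trichotomy (zCoord p) 0 with h | h | h
  · rw [reflectExt, reflectExt, if_neg h.not_ge, if_pos (by linarith)]; simp
  · rw [reflect_eq_self h, reflectExt, if_pos h.ge, h0 p h, neg_zero]
  · rw [reflectExt, reflectExt, if_pos h.le, if_neg (by linarith)]; simp

theorem IsDirichletSolution.isReflectable {φ : halfSpace → 𝕜} (h : IsDirichletSolution halfSpace φ) :
    IsReflectable Set.univ (-1) (zeroExtend φ) := by
  refine ⟨?_, ?_, fun p _ hz => ?_, fun p _ _ => by simp⟩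
  · rw [Set.inter_univ]; exact h.contDiffOn
  · rw [Set.inter_univ]; exact h.wave
  · have : zeroExtend φ p = 0 :=
      (zeroExtend_apply φ ⟨p, hz.ge⟩).trans (h.boundary ⟨p, hz.ge⟩ (mem_frontier_halfSpace.2 hz))
    rw [this, smul_zero]

theorem dirDerivWithin_eq_dirDeriv {Ω : Set Spacetime} (hΩ : UniqueDiffOn ℝ Ω) (v : Spacetime)
    {φ : Spacetime → 𝕜} {ψ : smooth 𝕜} (h : Set.EqOn φ ψ Ω) :
    Set.EqOn (dirDerivWithin Ω v φ) (dirDeriv v ψ : Spacetime → 𝕜) Ω := fun p hp => by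
  rw [dirDerivWithin_congr h hp, dirDerivWithin,
    (smooth_differentiable ψ p).fderivWithin (hΩ p hp), dirDeriv_apply]

theorem waveOpWithin_eq_waveOp {Ω : Set Spacetime} (hΩ : UniqueDiffOn ℝ Ω)
    {φ : Spacetime → 𝕜} {ψ : smooth 𝕜} (h : Set.EqOn φ ψ Ω) {p : Spacetime} (hp : p ∈ Ω) :
    waveOpWithin Ω φ p = (waveOp ψ : Spacetime → 𝕜) p := by
  rw [waveOpWithin, waveOp_apply]
  congr 1
  · rw [dirDerivWithin_eq_dirDeriv hΩ _ (dirDerivWithin_eq_dirDeriv hΩ _ h) hp]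
  · exact Finset.sum_congr rfl fun i _ =>
      dirDerivWithin_eq_dirDeriv hΩ _ (dirDerivWithin_eq_dirDeriv hΩ _ h) hp

/-- An odd function is determined by its values on the half-space. -/
theorem eq_of_oddAbout_of_eqOn_halfSpace {f g : smooth 𝕜} (hf : f ∈ oddAbout 𝕜 0)
    (hg : g ∈ oddAbout 𝕜 0) (h : Set.EqOn (f : Spacetime → 𝕜) g halfSpace) : f = g := by
  ext p
  rcases le_total 0 (zCoord p) with hz | hz
  · exact h hz
  · rw [hf p, hg p, h (show 0 ≤ zCoord (reflect 0 p) by rw [zCoord_reflect]; linarith)]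

theorem existsUnique_extension_halfSpace {φ : halfSpace → 𝕜}
    (hφ : IsDirichletSolution halfSpace φ) :
    ∃! ψ : smooth 𝕜, waveOp ψ = 0 ∧ ψ ∈ oddAbout 𝕜 0 ∧
      ∀ p : halfSpace, (ψ : Spacetime → 𝕜) p = φ p := by
  have h0 : ∀ p, zCoord p = 0 → zeroExtend φ p = 0 := fun p hz =>
    (zeroExtend_apply φ ⟨p, hz.ge⟩).trans (hφ.boundary ⟨p, hz.ge⟩ (mem_frontier_halfSpace.2 hz))
  have hs := hφ.isReflectable.contDiffOn_reflectExt isOpen_univ (fun _ _ => Set.mem_univ _)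
  let ψ : smooth 𝕜 := ⟨reflectExt (-1) (zeroExtend φ), contDiffOn_univ.1 hs⟩
  have hodd : ψ ∈ oddAbout 𝕜 0 := reflectExt_neg_one_mem_oddAbout h0
  have heq : Set.EqOn (zeroExtend φ) ψ halfSpace := fun p hp => (if_pos hp).symm
  refine ⟨ψ, ⟨?_, hodd, fun p => ?_⟩, fun ψ' ⟨_, hodd', h'⟩ => ?_⟩
  · refine eq_of_oddAbout_of_eqOn_halfSpace (waveOp_mem_oddAbout hodd) (Submodule.zero_mem _)
      fun p hp => ?_
    rw [← waveOpWithin_eq_waveOp uniqueDiffOn_halfSpace heq hp, hφ.wave p hp]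
    rfl
  · rw [← heq p.2, zeroExtend_apply]
  · refine eq_of_oddAbout_of_eqOn_halfSpace hodd' hodd fun p hp => ?_
    rw [← heq hp]
    exact (h' ⟨p, hp⟩).trans (zeroExtend_apply φ ⟨p, hp⟩).symm

/-! ### Unfolding the slab -/

/-- The point `(t, x, y, a)` for `p = (t, x, y, z)`. -/
def withZ (p : Spacetime) (a : ℝ) : Spacetime := (p.1, !₂[p.2 0, p.2 1, a])

@[simp] theorem zCoord_withZ (p : Spacetime) (a : ℝ) : zCoord (withZ p a) = a := by
  simp [zCoord, withZ]

@[simp] theorem withZ_withZ (p : Spacetime) (a b : ℝ) : withZ (withZ p a) b = withZ p b := by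
  simp [withZ]

@[simp] theorem withZ_zCoord (p : Spacetime) : withZ p (zCoord p) = p := by
  refine Prod.ext rfl ?_
  ext j
  fin_cases j <;> simp [withZ, zCoord]

theorem reflect_eq_withZ (c : ℝ) (p : Spacetime) : reflect c p = withZ p (2 * c - zCoord p) := rfl

theorem contDiff_withZ {a : Spacetime → ℝ} (ha : ContDiff ℝ ∞ a) :
    ContDiff ℝ ∞ fun p => withZ p (a p) := by
  refine contDiff_fst.prodMk (contDiff_euclidean.2 fun i => ?_)
  fin_cases i
  · change ContDiff ℝ ∞ fun p : Spacetime => p.2 0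
    fun_prop
  · change ContDiff ℝ ∞ fun p : Spacetime => p.2 1
    fun_prop
  · exact ha

theorem contDiff_zCoord : ContDiff ℝ ∞ zCoord := by
  unfold zCoord; fun_prop

theorem exists_eq_add_zsmul {d : ℝ} (hd : 0 < d) (z : ℝ) :
    ∃ k : ℤ, ∃ w, -d ≤ w ∧ w < d ∧ z = w + k * (2 * d) := by
  have hm := toIcoMod_mem_Ico (mul_pos two_pos hd) (-d) z
  refine ⟨toIcoDiv (mul_pos two_pos hd) (-d) z, toIcoMod (mul_pos two_pos hd) (-d) z,
    hm.1, by linarith [hm.2], ?_⟩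
  rw [← zsmul_eq_mul, toIcoMod_add_toIcoDiv_zsmul]

section Fold

variable {d : ℝ} (hd : 0 < d)

/-- The extension of `h : [0, d] → 𝕜` to a `2d`-periodic odd function on the line. -/
noncomputable def oddFold (h : ℝ → 𝕜) (z : ℝ) : 𝕜 :=
  if 0 ≤ toIcoMod (mul_pos two_pos hd) (-d) z then h (toIcoMod (mul_pos two_pos hd) (-d) z)
  else -h (-toIcoMod (mul_pos two_pos hd) (-d) z)

variable {h : ℝ → 𝕜}

theorem oddFold_of_mem {z : ℝ} (h1 : -d ≤ z) (h2 : z < d) :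
    oddFold hd h z = if 0 ≤ z then h z else -h (-z) := by
  have : toIcoMod (mul_pos two_pos hd) (-d) z = z :=
    (toIcoMod_eq_self _).2 ⟨h1, by linarith⟩
  rw [oddFold, this]

theorem oddFold_add_zsmul (z : ℝ) (k : ℤ) : oddFold hd h (z + k * (2 * d)) = oddFold hd h z := by
  rw [oddFold, oddFold, ← zsmul_eq_mul, toIcoMod_add_zsmul]

theorem oddFold_eq_of_mem_Icc (h0 : h d = 0) {z : ℝ} (h1 : 0 ≤ z) (h2 : z ≤ d) :
    oddFold hd h z = h z := by
  rcases h2.lt_or_eq with h2 | rfl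
  · rw [oddFold_of_mem hd (by linarith) h2, if_pos h1]
  · have := oddFold_add_zsmul hd (h := h) (-z) 1
    rw [show -z + ((1 : ℤ) : ℝ) * (2 * z) = z by push_cast; ring,
      oddFold_of_mem hd le_rfl (by linarith), if_neg (by linarith), neg_neg, h0] at this
    rw [this, h0, neg_zero]

theorem oddFold_neg (h0 : h 0 = 0) (hd0 : h d = 0) (z : ℝ) :
    oddFold hd h (-z) = -oddFold hd h z := by
  obtain ⟨k, w, h1, h2, rfl⟩ := exists_eq_add_zsmul hd z
  have e : -(w + k * (2 * d)) = -w + ((-k : ℤ) : ℝ) * (2 * d) := by push_cast; ring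
  rw [e, oddFold_add_zsmul, oddFold_add_zsmul]
  rcases h1.lt_or_eq with h1 | rfl
  · rw [oddFold_of_mem hd (by linarith) (by linarith), oddFold_of_mem hd h1.le h2]
    rcases lt_trichotomy w 0 with hw | rfl | hw
    · rw [if_pos (by linarith), if_neg (by linarith), neg_neg]
    · simp [h0]
    · rw [if_neg (by linarith), if_pos hw.le, neg_neg]
  · rw [neg_neg, oddFold_eq_of_mem_Icc hd hd0 hd.le le_rfl, oddFold_of_mem hd le_rfl (by linarith),
      if_neg (by linarith), neg_neg, neg_neg, hd0]

theorem oddFold_two_mul_sub (h0 : h 0 = 0) (hd0 : h d = 0) (z : ℝ) :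
    oddFold hd h (2 * d - z) = -oddFold hd h z := by
  have := oddFold_add_zsmul hd (h := h) (-z) 1
  rw [← oddFold_neg hd h0 hd0, ← this]
  congr 1; push_cast; ring

theorem oddFold_of_mem_upper (h0 : h 0 = 0) (hd0 : h d = 0) {z : ℝ} (h1 : 0 < z) (h2 : z < 2 * d) :
    oddFold hd h z = if 0 ≤ d - z then h z else -h (2 * d - z) := by
  split_ifs with hz
  · exact oddFold_eq_of_mem_Icc hd hd0 h1.le (by linarith)
  · rw [← oddFold_eq_of_mem_Icc hd hd0 (z := 2 * d - z) (by linarith) (by linarith),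
      oddFold_two_mul_sub hd h0 hd0, neg_neg]

end Fold

/-- A function on `ℝ⁴` which restricts to a smooth Dirichlet solution on the slab. -/
structure IsSlabSolution (d : ℝ) (φ : Spacetime → 𝕜) : Prop where
  contDiffOn : ContDiffOn ℝ ∞ φ (slab d)
  wave : ∀ p ∈ slab d, waveOpWithin (slab d) φ p = 0
  boundary_zero : ∀ p, zCoord p = 0 → φ p = 0
  boundary_top : ∀ p, zCoord p = d → φ p = 0

theorem IsDirichletSolution.isSlabSolution {d : ℝ} (hd : 0 < d) {φ : slab d → 𝕜}
    (h : IsDirichletSolution (slab d) φ) : IsSlabSolution d (zeroExtend φ) := by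
  refine ⟨h.contDiffOn, h.wave, fun p hz => ?_, fun p hz => ?_⟩
  · have hp : p ∈ slab d := ⟨hz.ge, hz.le.trans hd.le⟩
    exact (zeroExtend_apply φ ⟨p, hp⟩).trans
      (h.boundary ⟨p, hp⟩ ((mem_frontier_slab hd).2 (Or.inl hz)))
  · have hp : p ∈ slab d := ⟨hd.le.trans hz.ge, hz.le⟩
    exact (zeroExtend_apply φ ⟨p, hp⟩).trans
      (h.boundary ⟨p, hp⟩ ((mem_frontier_slab hd).2 (Or.inr hz)))

theorem dirDerivWithin_comp_reflect {Ω : Set Spacetime} (hΩ : UniqueDiffOn ℝ Ω) {c : ℝ}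
    (hR : Set.MapsTo (reflect c) Ω Ω) {ε : ℝ} {v : Spacetime}
    (hv : ∀ (p : Spacetime) (s : ℝ), reflect c (p + s • v) = reflect c p + (ε * s) • v)
    {φ : Spacetime → 𝕜} (hφ : ContDiffOn ℝ ∞ φ Ω) {p : Spacetime} (hp : p ∈ Ω) :
    dirDerivWithin Ω v (φ ∘ reflect c) p = ε • dirDerivWithin Ω v φ (reflect c p) := by
  have h1 := (hφ.differentiableOn (by simp) _ (hR hp)).hasFDerivWithinAt.comp p
    (((contDiff_reflect c).differentiable (by simp) p).hasFDerivAt.hasFDerivWithinAt) hR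
  rw [dirDerivWithin, h1.fderivWithin (hΩ p hp)]
  simp [fderiv_reflect_apply c hv, dirDerivWithin]

theorem waveOpWithin_comp_reflect {Ω : Set Spacetime} (hΩ : UniqueDiffOn ℝ Ω) {c : ℝ}
    (hR : Set.MapsTo (reflect c) Ω Ω) {φ : Spacetime → 𝕜} (hφ : ContDiffOn ℝ ∞ φ Ω)
    {p : Spacetime} (hp : p ∈ Ω) :
    waveOpWithin Ω (φ ∘ reflect c) p = waveOpWithin Ω φ (reflect c p) := by
  have key : ∀ (v : Spacetime) (ε : ℝ), ε * ε = 1 →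
      (∀ (p : Spacetime) (s : ℝ), reflect c (p + s • v) = reflect c p + (ε * s) • v) →
      dirDerivWithin Ω v (dirDerivWithin Ω v (φ ∘ reflect c)) p =
        dirDerivWithin Ω v (dirDerivWithin Ω v φ) (reflect c p) := by
    intro v ε hε hv
    have h1 := dirDerivWithin_contDiffOn hΩ v hφ
    have h2 : Set.EqOn (dirDerivWithin Ω v (φ ∘ reflect c))
        ((fun q => ε • dirDerivWithin Ω v φ q) ∘ reflect c) Ω :=
      fun q hq => dirDerivWithin_comp_reflect hΩ hR hv hφ hq
    have h3 : dirDerivWithin Ω v (fun q => ε • dirDerivWithin Ω v φ q) (reflect c p) =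
        ε • dirDerivWithin Ω v (dirDerivWithin Ω v φ) (reflect c p) := by
      have := ((h1.differentiableOn (by simp) _ (hR hp)).hasFDerivWithinAt.const_smul
        ε).fderivWithin (hΩ _ (hR hp))
      exact congrArg (fun L : Spacetime →L[ℝ] 𝕜 => L v) this
    rw [dirDerivWithin_congr h2 hp,
      dirDerivWithin_comp_reflect hΩ hR hv (φ := fun q => ε • dirDerivWithin Ω v φ q)
        (h1.const_smul ε) hp, h3, smul_smul, hε,
      one_smul]
  rw [waveOpWithin, waveOpWithin, key timeDir 1 (by norm_num) (reflect_timeDir c)]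
  congr 1
  exact Finset.sum_congr rfl fun i _ =>
    key (spaceDir i) _ (by split_ifs <;> norm_num) (reflect_spaceDir c i)

theorem IsSlabSolution.comp_reflect {d : ℝ} (hd : 0 < d) {φ : Spacetime → 𝕜}
    (h : IsSlabSolution d φ) : IsSlabSolution d (φ ∘ reflect (d / 2)) := by
  have hR : Set.MapsTo (reflect (d / 2)) (slab d) (slab d) := by
    rintro p ⟨h1, h2⟩
    constructor <;> rw [zCoord_reflect] <;> linarith
  refine ⟨h.contDiffOn.comp (contDiff_reflect _).contDiffOn hR, fun p hp => ?_, fun p hz => ?_,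
    fun p hz => ?_⟩
  · rw [waveOpWithin_comp_reflect (uniqueDiffOn_slab hd) hR h.contDiffOn hp, h.wave _ (hR hp)]
  · exact h.boundary_top _ (by rw [zCoord_reflect, hz]; ring)
  · exact h.boundary_zero _ (by rw [zCoord_reflect, hz]; ring)

theorem waveOpWithin_inter {Ω V : Set Spacetime} (hV : IsOpen V) (φ : Spacetime → 𝕜)
    {p : Spacetime} (hp : p ∈ V) (hpΩ : p ∈ Ω) :
    waveOpWithin (Ω ∩ V) φ p = waveOpWithin Ω φ p := by
  have h1 : ∀ (v : Spacetime) (ψ : Spacetime → 𝕜), ∀ q ∈ V,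
      dirDerivWithin (Ω ∩ V) v ψ q = dirDerivWithin Ω v ψ q := fun v ψ q hq => by
    rw [dirDerivWithin, dirDerivWithin, fderivWithin_inter (hV.mem_nhds hq)]
  have h2 : ∀ v : Spacetime, dirDerivWithin (Ω ∩ V) v (dirDerivWithin (Ω ∩ V) v φ) p =
      dirDerivWithin Ω v (dirDerivWithin Ω v φ) p := fun v => by
    rw [← h1 v (dirDerivWithin Ω v φ) p hp]
    exact dirDerivWithin_congr (fun q hq => h1 v φ q hq.2) ⟨hpΩ, hp⟩
  simp only [waveOpWithin, h2]

/-- The open slab `{|z| < d}`. -/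
def symmetricSlab (d : ℝ) : Set Spacetime := {p | -d < zCoord p ∧ zCoord p < d}

theorem isOpen_symmetricSlab (d : ℝ) : IsOpen (symmetricSlab d) :=
  (isOpen_lt continuous_const continuous_zCoord).inter
    (isOpen_lt continuous_zCoord continuous_const)

theorem IsSlabSolution.contDiffOn_reflectExt {d : ℝ} {φ : Spacetime → 𝕜}
    (h : IsSlabSolution d φ) : ContDiffOn ℝ ∞ (reflectExt (-1) φ) (symmetricSlab d) := by
  have e : halfSpace ∩ symmetricSlab d = slab d ∩ symmetricSlab d := by
    ext p
    exact ⟨fun hp => ⟨⟨hp.1, hp.2.2.le⟩, hp.2⟩, fun hp => ⟨hp.1.1, hp.2⟩⟩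
  have hr : IsReflectable (symmetricSlab d) (-1) φ := by
    refine ⟨?_, fun p hp => ?_, fun p _ hz => ?_, fun p _ _ => by simp⟩
    · rw [e]; exact h.contDiffOn.mono Set.inter_subset_left
    · rw [e] at hp ⊢
      rw [waveOpWithin_inter (isOpen_symmetricSlab d) φ hp.2 hp.1, h.wave p hp.1]
    · rw [h.boundary_zero p hz, smul_zero]
  refine hr.contDiffOn_reflectExt (isOpen_symmetricSlab d) fun p hp => ?_
  constructor <;> rw [zCoord_reflect] <;> linarith [hp.1, hp.2]

/-- The extension of a function on the slab to all of spacetime, odd under the reflections at both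
boundary planes. -/
noncomputable def slabExt {d : ℝ} (hd : 0 < d) (φ : Spacetime → 𝕜) (p : Spacetime) : 𝕜 :=
  oddFold hd (fun z => φ (withZ p z)) (zCoord p)

theorem slabExt_eq_reflectExt {d : ℝ} (hd : 0 < d) (φ : Spacetime → 𝕜) {p : Spacetime}
    (hp : p ∈ symmetricSlab d) : slabExt hd φ p = reflectExt (-1) φ p := by
  rw [slabExt, oddFold_of_mem hd hp.1.le hp.2, reflectExt, withZ_zCoord, reflect_eq_withZ]
  simp

theorem IsSlabSolution.slabExt_eq_reflectExt_reflect {d : ℝ} (hd : 0 < d) {φ : Spacetime → 𝕜}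
    (h : IsSlabSolution d φ) {p : Spacetime} (h1 : 0 < zCoord p) (h2 : zCoord p < 2 * d) :
    slabExt hd φ p = reflectExt (-1) (φ ∘ reflect (d / 2)) (reflect (d / 2) p) := by
  rw [slabExt, oddFold_of_mem_upper hd (h.boundary_zero _ (by simp)) (h.boundary_top _ (by simp))
    h1 h2, reflectExt]
  have e1 : zCoord (reflect (d / 2) p) = d - zCoord p := by rw [zCoord_reflect]; ring
  rw [e1]
  congr 1
  · simp
  · simp only [Function.comp_apply, reflect_eq_withZ, withZ_withZ, zCoord_withZ, neg_smul, one_smul]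
    congr 3; ring

theorem slabExt_withZ_add {d : ℝ} (hd : 0 < d) (φ : Spacetime → 𝕜) (k : ℤ) (p : Spacetime) :
    slabExt hd φ (withZ p (zCoord p + k * (2 * d))) = slabExt hd φ p := by
  simp [slabExt, oddFold_add_zsmul]

theorem IsSlabSolution.contDiff_slabExt {d : ℝ} (hd : 0 < d) {φ : Spacetime → 𝕜}
    (h : IsSlabSolution d φ) : ContDiff ℝ ∞ (slabExt hd φ) := by
  rw [contDiff_iff_contDiffAt]
  intro p
  -- By periodicity smoothness at `p` follows from smoothness at any translate of `p` by `2kd`.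
  have hshift : ∀ k : ℤ, ContDiffAt ℝ ∞ (slabExt hd φ) (withZ p (zCoord p + k * (2 * d))) →
      ContDiffAt ℝ ∞ (slabExt hd φ) p := fun k hk => by
    have hc : ContDiff ℝ ∞ fun q : Spacetime => withZ q (zCoord q + k * (2 * d)) :=
      contDiff_withZ (contDiff_zCoord.add contDiff_const)
    have := ContDiffAt.comp p hk hc.contDiffAt
    exact this.congr_of_eventuallyEq
      (Eventually.of_forall fun q => (slabExt_withZ_add hd φ k q).symm)
  obtain ⟨k, w, h1, h2, hw⟩ := exists_eq_add_zsmul hd (zCoord p)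
  rcases h1.lt_or_eq with h1 | rfl
  · refine hshift (-k) ?_
    have hq : withZ p (zCoord p + ((-k : ℤ) : ℝ) * (2 * d)) ∈ symmetricSlab d := by
      have e : zCoord p + ((-k : ℤ) : ℝ) * (2 * d) = w := by rw [hw]; push_cast; ring
      rw [e]
      exact ⟨by simpa using h1, by simpa using h2⟩
    have hn := (isOpen_symmetricSlab d).mem_nhds hq
    refine ((h.contDiffOn_reflectExt).contDiffAt hn).congr_of_eventuallyEq ?_
    filter_upwards [hn] with q hq using slabExt_eq_reflectExt hd φ hq
  · refine hshift (1 - k) ?_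
    have e : zCoord p + ((1 - k : ℤ) : ℝ) * (2 * d) = d := by rw [hw]; push_cast; ring
    rw [e]
    have hV : IsOpen {q : Spacetime | 0 < zCoord q ∧ zCoord q < 2 * d} :=
      (isOpen_lt continuous_const continuous_zCoord).inter
        (isOpen_lt continuous_zCoord continuous_const)
    have hn := hV.mem_nhds (x := withZ p d) ⟨by simpa using hd, by simp; linarith⟩
    have hs := ((h.comp_reflect hd).contDiffOn_reflectExt).contDiffAt
      ((isOpen_symmetricSlab d).mem_nhds (x := reflect (d / 2) (withZ p d))
        ⟨by simp; linarith, by simp; linarith⟩)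
    refine (ContDiffAt.comp _ hs (contDiff_reflect _).contDiffAt).congr_of_eventuallyEq ?_
    filter_upwards [hn] with q hq using h.slabExt_eq_reflectExt_reflect hd hq.1 hq.2

/-- A function odd about both boundary planes is determined by its values on the slab. -/
theorem eq_of_oddAbout_of_eqOn_slab {d : ℝ} (hd : 0 < d) {f g : smooth 𝕜}
    (hf : f ∈ oddAbout 𝕜 0) (hfd : f ∈ oddAbout 𝕜 d) (hg : g ∈ oddAbout 𝕜 0)
    (hgd : g ∈ oddAbout 𝕜 d) (h : Set.EqOn (f : Spacetime → 𝕜) g (slab d)) : f = g := by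
  have h1 : ∀ p, -d ≤ zCoord p → zCoord p < d → (f : Spacetime → 𝕜) p = (g : Spacetime → 𝕜) p := by
    intro p hp1 hp2
    rcases le_total 0 (zCoord p) with hz | hz
    · exact h ⟨hz, hp2.le⟩
    · have : reflect 0 p ∈ slab d := by
        constructor <;> rw [zCoord_reflect] <;> linarith
      rw [hf p, hg p, h this]
  have hper : ∀ u : smooth 𝕜, u ∈ oddAbout 𝕜 0 → u ∈ oddAbout 𝕜 d → ∀ (p : Spacetime) (k : ℤ),
      (u : Spacetime → 𝕜) (withZ p (zCoord p + k * (2 * d))) = (u : Spacetime → 𝕜) p := by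
    intro u hu hud p k
    have hstep : ∀ q : Spacetime,
        (u : Spacetime → 𝕜) (withZ q (zCoord q + 2 * d)) = (u : Spacetime → 𝕜) q := fun q => by
      rw [hu q, hud (reflect 0 q), neg_neg]
      simp only [reflect_eq_withZ, withZ_withZ, zCoord_withZ]
      exact congrArg (fun a => (u : Spacetime → 𝕜) (withZ q a)) (by ring)
    induction k with
    | zero => simp
    | succ k ih =>
      rw [← ih, ← hstep (withZ p (zCoord p + ((k : ℤ) : ℝ) * (2 * d)))]
      rw [withZ_withZ, zCoord_withZ]
      exact congrArg (fun a => (u : Spacetime → 𝕜) (withZ p a)) (by push_cast; ring)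
    | pred k ih =>
      rw [← ih, ← hstep (withZ p (zCoord p + ((-(k : ℤ) - 1 : ℤ) : ℝ) * (2 * d)))]
      rw [withZ_withZ, zCoord_withZ]
      exact congrArg (fun a => (u : Spacetime → 𝕜) (withZ p a)) (by push_cast; ring)
  ext p
  obtain ⟨k, w, hw1, hw2, hw⟩ := exists_eq_add_zsmul hd (zCoord p)
  have e : zCoord p + ((-k : ℤ) : ℝ) * (2 * d) = w := by rw [hw]; push_cast; ring
  rw [← hper f hf hfd p (-k), ← hper g hg hgd p (-k), e]
  exact h1 _ (by simpa using hw1) (by simpa using hw2)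

theorem existsUnique_extension_slab {d : ℝ} (hd : 0 < d) {φ : slab d → 𝕜}
    (hφ : IsDirichletSolution (slab d) φ) :
    ∃! ψ : smooth 𝕜, waveOp ψ = 0 ∧ ψ ∈ oddAbout 𝕜 0 ∧ ψ ∈ oddAbout 𝕜 d ∧
      ∀ p : slab d, (ψ : Spacetime → 𝕜) p = φ p := by
  have hs := hφ.isSlabSolution hd
  let ψ : smooth 𝕜 := ⟨slabExt hd (zeroExtend φ), hs.contDiff_slabExt hd⟩
  have hb0 : ∀ p : Spacetime, zeroExtend φ (withZ p 0) = 0 := fun p => hs.boundary_zero _ (by simp)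
  have hbd : ∀ p : Spacetime, zeroExtend φ (withZ p d) = 0 := fun p => hs.boundary_top _ (by simp)
  have hodd : ψ ∈ oddAbout 𝕜 0 := fun p => by
    change slabExt hd (zeroExtend φ) p = -slabExt hd (zeroExtend φ) (reflect 0 p)
    simp only [slabExt, reflect_eq_withZ, withZ_withZ, zCoord_withZ, mul_zero, zero_sub]
    rw [oddFold_neg hd (hb0 p) (hbd p), neg_neg]
  have hoddd : ψ ∈ oddAbout 𝕜 d := fun p => by
    change slabExt hd (zeroExtend φ) p = -slabExt hd (zeroExtend φ) (reflect d p)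
    simp only [slabExt, reflect_eq_withZ, withZ_withZ, zCoord_withZ]
    rw [oddFold_two_mul_sub hd (hb0 p) (hbd p), neg_neg]
  have heq : Set.EqOn (zeroExtend φ) ψ (slab d) := fun p hp => by
    change _ = slabExt hd (zeroExtend φ) p
    rw [slabExt, oddFold_eq_of_mem_Icc hd (hbd p) hp.1 hp.2, withZ_zCoord]
  refine ⟨ψ, ⟨?_, hodd, hoddd, fun p => ?_⟩, fun ψ' ⟨_, hodd', hoddd', h'⟩ => ?_⟩
  · refine eq_of_oddAbout_of_eqOn_slab hd (waveOp_mem_oddAbout hodd) (waveOp_mem_oddAbout hoddd)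
      (Submodule.zero_mem _) (Submodule.zero_mem _) fun p hp => ?_
    rw [← waveOpWithin_eq_waveOp (uniqueDiffOn_slab hd) heq hp, hφ.wave p hp]
    rfl
  · rw [← heq p.2, zeroExtend_apply]
  · refine eq_of_oddAbout_of_eqOn_slab hd hodd' hoddd' hodd hoddd fun p hp => ?_
    rw [← heq hp]
    exact (h' ⟨p, hp⟩).trans (zeroExtend_apply φ ⟨p, hp⟩).symm

/-! ### Classification of the solutions by sources -/

/-- The product of `f` with a smooth function of time which is `0` for `t ≤ 0` and `1` for
`t ≥ 1`. -/
noncomputable def timeCutoff (f : smooth 𝕜) : smooth 𝕜 :=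
  ⟨fun p => Real.smoothTransition p.1 • (f : Spacetime → 𝕜) p,
    ((Real.smoothTransition.contDiff (n := ⊤)).comp contDiff_fst).smul (contDiff_smooth f)⟩

theorem timeCutoff_apply (f : smooth 𝕜) (p : Spacetime) : (timeCutoff f : Spacetime → 𝕜) p =
    Real.smoothTransition p.1 • (f : Spacetime → 𝕜) p := rfl

theorem timeCutoff_mem_oddAbout {c : ℝ} {f : smooth 𝕜} (hf : f ∈ oddAbout 𝕜 c) :
    timeCutoff f ∈ oddAbout 𝕜 c := fun p => by
  rw [timeCutoff_apply, timeCutoff_apply, hf p, smul_neg]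
  rfl

theorem isHalfCompact_tsupport_timeCutoff (f : smooth 𝕜) :
    IsHalfCompact 1 (tsupport (timeCutoff f : Spacetime → 𝕜)) := by
  refine IsHalfCompact.of_time_bounded abs_one (isClosed_tsupport _) 0 fun p hp => ?_
  rw [one_mul]
  refine closure_minimal (t := {q : Spacetime | 0 ≤ q.1}) (fun q hq => ?_)
    (isClosed_le continuous_const continuous_fst) hp
  by_contra h
  refine hq ?_
  rw [timeCutoff_apply, Real.smoothTransition.zero_of_nonpos (not_le.1 h).le, zero_smul]

theorem isHalfCompact_tsupport_sub_timeCutoff (f : smooth 𝕜) :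
    IsHalfCompact (-1) (tsupport ((f - timeCutoff f : smooth 𝕜) : Spacetime → 𝕜)) := by
  refine IsHalfCompact.of_time_bounded abs_neg_one_eq (isClosed_tsupport _) (-1) fun p hp => ?_
  have : p.1 ≤ 1 := by
    refine closure_minimal (t := {q : Spacetime | q.1 ≤ 1}) (fun q hq => ?_)
      (isClosed_le continuous_fst continuous_const) hp
    by_contra h
    refine hq ?_
    change (f : Spacetime → 𝕜) q - (timeCutoff f : Spacetime → 𝕜) q = 0
    rw [timeCutoff_apply, Real.smoothTransition.one_of_one_le (not_le.1 h).le, one_smul, sub_self]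
  linarith

theorem eq_zero_of_oddAbout {c : ℝ} {f : smooth 𝕜} (hf : f ∈ oddAbout 𝕜 c) {p : Spacetime}
    (hp : zCoord p = c) : (f : Spacetime → 𝕜) p = 0 := by
  have := hf p
  rw [reflect_eq_self hp] at this
  exact self_eq_neg.1 this

/-- The restriction to `Ω` of a solution on Minkowski spacetime which is odd about the boundary
planes of `Ω` is a Dirichlet solution. -/
theorem isDirichletSolution_restrict {Ω : Set Spacetime} (hΩ : UniqueDiffOn ℝ Ω) {C : Set ℝ}
    (hfr : ∀ p ∈ frontier Ω, zCoord p ∈ C) {ψ : smooth 𝕜} (hψ : ∀ c ∈ C, ψ ∈ oddAbout 𝕜 c)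
    (hw : waveOp ψ = 0) : IsDirichletSolution Ω fun p : Ω => (ψ : Spacetime → 𝕜) p := by
  have heq : Set.EqOn (zeroExtend fun p : Ω => (ψ : Spacetime → 𝕜) p) ψ Ω := fun p hp =>
    zeroExtend_apply (fun p : Ω => (ψ : Spacetime → 𝕜) p) ⟨p, hp⟩
  refine ⟨(contDiff_smooth ψ).contDiffOn.congr heq, fun p hp => ?_, fun p hp => ?_⟩
  · rw [waveOpWithin_eq_waveOp hΩ heq hp, hw]
    rfl
  · exact eq_zero_of_oddAbout (hψ _ (hfr p hp)) rfl

theorem exists_quotient_equiv {R V W : Type*} [Ring R] [AddCommGroup V] [Module R V]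
    [AddCommGroup W] [Module R W] {K : Submodule R V} (T : V →ₗ[R] W) (hK : K = LinearMap.ker T)
    (hT : Function.Surjective T) :
    ∃ Φ : (V ⧸ K) ≃ₗ[R] W, ∀ v, Φ (Submodule.Quotient.mk v) = T v := by
  subst hK
  exact ⟨T.quotKerEquivOfSurjective hT, fun v => rfl⟩

/-- Let `C` be the set of the heights of the boundary planes of `Ω`. If Dirichlet solutions on `Ω`
are uniquely the restrictions of solutions on Minkowski spacetime which are odd about these planes,
then the causal propagator identifies the classes of odd sources with the Dirichlet solutions. -/
theorem exists_causalPropagator_equiv {Ω : Set Spacetime} (hΩ : UniqueDiffOn ℝ Ω) {C : Set ℝ}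
    (hfr : ∀ p ∈ frontier Ω, zCoord p ∈ C) {A : Submodule 𝕜 (smooth 𝕜)} (hA : A ≤ smoothTC 𝕜)
    (hAC : ∀ f, f ∈ A ↔ f ∈ smoothTC 𝕜 ∧ ∀ c ∈ C, f ∈ oddAbout 𝕜 c)
    (hext : ∀ φ : Ω → 𝕜, IsDirichletSolution Ω φ → ∃ ψ : smooth 𝕜, waveOp ψ = 0 ∧
      (∀ c ∈ C, ψ ∈ oddAbout 𝕜 c) ∧ ∀ p : Ω, (ψ : Spacetime → 𝕜) p = φ p)
    (huniq : ∀ f g : smooth 𝕜, (∀ c ∈ C, f ∈ oddAbout 𝕜 c) → (∀ c ∈ C, g ∈ oddAbout 𝕜 c) →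
      Set.EqOn (f : Spacetime → 𝕜) g Ω → f = g)
    {Ea Er : smoothTC 𝕜 →ₗ[𝕜] smooth 𝕜} (ha : IsGreen (-1) Ea) (hr : IsGreen 1 Er) :
    ∃ Φ : QuotByImage waveOp A ≃ₗ[𝕜] dirichletSolutions 𝕜 Ω hΩ,
      ∀ (α : A) (p : Ω), (Φ (Submodule.Quotient.mk α) : Ω → 𝕜) p =
        ((Ea - Er) (Submodule.inclusion hA α) : Spacetime → 𝕜) p := by
  have hodd : ∀ (α : A), ∀ c ∈ C, Ea (Submodule.inclusion hA α) ∈ oddAbout 𝕜 c ∧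
      Er (Submodule.inclusion hA α) ∈ oddAbout 𝕜 c := fun α c hc => by
    have hα := ((hAC _).1 α.2).2 c hc
    exact ⟨ha.mem_oddAbout abs_neg_one_eq (α := Submodule.inclusion hA α) hα,
      hr.mem_oddAbout abs_one (α := Submodule.inclusion hA α) hα⟩
  let T₀ : A →ₗ[𝕜] (Ω → 𝕜) := LinearMap.funLeft 𝕜 𝕜 (Subtype.val : Ω → Spacetime) ∘ₗ
    (smooth 𝕜).subtype ∘ₗ (Ea - Er) ∘ₗ Submodule.inclusion hA
  have hT₀ : ∀ α, T₀ α ∈ dirichletSolutions 𝕜 Ω hΩ := fun α =>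
    isDirichletSolution_restrict hΩ hfr (ψ := (Ea - Er) (Submodule.inclusion hA α))
      (fun c hc => (oddAbout 𝕜 c).sub_mem (hodd α c hc).1 (hodd α c hc).2)
      (by rw [LinearMap.sub_apply, map_sub, ha.wave_apply, hr.wave_apply, sub_self])
  let T : A →ₗ[𝕜] dirichletSolutions 𝕜 Ω hΩ := T₀.codRestrict _ hT₀
  have hT : ∀ (α : A) (p : Ω), (T α : Ω → 𝕜) p =
      ((Ea - Er) (Submodule.inclusion hA α) : Spacetime → 𝕜) p := fun _ _ => rfl
  have hker : (A.map waveOp).submoduleOf A = LinearMap.ker T := by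
    ext α
    constructor
    · rintro ⟨β, hβ, hβα⟩
      have hβ' : IsTimelikeCompact (tsupport (β : Spacetime → 𝕜)) := hA hβ
      have h1 := ha.apply_eq abs_neg_one_eq (α := Submodule.inclusion hA α)
        (IsTimelikeCompact.isHalfCompact abs_neg_one_eq hβ') hβα
      have h2 := hr.apply_eq abs_one (α := Submodule.inclusion hA α)
        (IsTimelikeCompact.isHalfCompact abs_one hβ') hβα
      refine LinearMap.mem_ker.2 (Subtype.ext (funext fun p => ?_))
      rw [hT, LinearMap.sub_apply, h1, h2, sub_self]
      rfl
    · intro hα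
      -- If the two potentials agree, their common value has timelike compact support.
      have h : Ea (Submodule.inclusion hA α) = Er (Submodule.inclusion hA α) := by
        refine huniq _ _ (fun c hc => (hodd α c hc).1) (fun c hc => (hodd α c hc).2)
          fun p hp => sub_eq_zero.1 ?_
        exact (hT α ⟨p, hp⟩).symm.trans (congrArg
          (fun φ : dirichletSolutions 𝕜 Ω hΩ => (φ : Ω → 𝕜) ⟨p, hp⟩) (LinearMap.mem_ker.1 hα))
      refine ⟨Er (Submodule.inclusion hA α), (hAC _).2 ⟨isTimelikeCompact_iff.2
        ⟨hr.isHalfCompact abs_one _, ?_⟩, fun c hc => (hodd α c hc).2⟩, hr.wave_apply _⟩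
      rw [← h]
      exact ha.isHalfCompact abs_neg_one_eq _
  have hsurj : Function.Surjective T := by
    rintro ⟨φ, hφ⟩
    obtain ⟨ψ, hw, hψ, hψφ⟩ := hext φ hφ
    -- The source `P (ψ - χ ψ) = -P (χ ψ)` lives in the slab of time where the cutoff `χ` varies.
    have hP : waveOp (ψ - timeCutoff ψ) = waveOp (-timeCutoff ψ) := by
      rw [map_sub, hw, map_neg, zero_sub]
    have hneg : IsHalfCompact 1 (tsupport ((-timeCutoff ψ : smooth 𝕜) : Spacetime → 𝕜)) := by
      have : tsupport ((-timeCutoff ψ : smooth 𝕜) : Spacetime → 𝕜) =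
          tsupport (timeCutoff ψ : Spacetime → 𝕜) := by simp [tsupport]
      rw [this]
      exact isHalfCompact_tsupport_timeCutoff ψ
    have hsub := isHalfCompact_tsupport_sub_timeCutoff ψ
    have hα : waveOp (ψ - timeCutoff ψ) ∈ A :=
      (hAC _).2 ⟨isTimelikeCompact_iff.2 ⟨hP ▸ hneg.waveOp, hsub.waveOp⟩, fun c hc =>
        waveOp_mem_oddAbout ((oddAbout 𝕜 c).sub_mem (hψ c hc) (timeCutoff_mem_oddAbout (hψ c hc)))⟩
    refine ⟨⟨_, hα⟩, Subtype.ext (funext fun p => ?_)⟩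
    rw [hT, LinearMap.sub_apply, ha.apply_eq abs_neg_one_eq hsub rfl,
      hr.apply_eq abs_one hneg hP.symm, sub_neg_eq_add, sub_add_cancel]
    exact hψφ p
  obtain ⟨Φ, hΦ⟩ := exists_quotient_equiv (R := 𝕜) (V := A) (W := dirichletSolutions 𝕜 Ω hΩ)
    (K := (A.map waveOp).submoduleOf A) T hker hsurj
  exact ⟨Φ, fun α p => by rw [hΦ, hT]⟩

end DirichletWave

theorem mainTheorem3 (𝕜 : Type*) [RCLike 𝕜] :
    -- the advanced and the retarded fundamental solutions exist and are unique
    (∃! Ea : smoothTC 𝕜 →ₗ[𝕜] smooth 𝕜, IsAdvanced Ea) ∧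
    (∃! Er : smoothTC 𝕜 →ₗ[𝕜] smooth 𝕜, IsRetarded Er) ∧
    -- Dirichlet solutions extend uniquely by odd reflection to solutions on Minkowski spacetime
    (∀ φ ∈ dirichletSolutions 𝕜 halfSpace uniqueDiffOn_halfSpace,
      ∃! ψ : smooth 𝕜, waveOp ψ = 0 ∧ ψ ∈ oddAbout 𝕜 0 ∧
        ∀ p : halfSpace, (ψ : Spacetime → 𝕜) p = φ p) ∧
    (∀ (d : ℝ) (hd : 0 < d), ∀ φ ∈ dirichletSolutions 𝕜 (slab d) (uniqueDiffOn_slab hd),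
      ∃! ψ : smooth 𝕜, waveOp ψ = 0 ∧ ψ ∈ oddAbout 𝕜 0 ∧ ψ ∈ oddAbout 𝕜 d ∧
        ∀ p : slab d, (ψ : Spacetime → 𝕜) p = φ p) ∧
    -- `[α] ↦ (E α)|_Ω`, with the causal propagator `E = Ea - Er`, is an isomorphism
    (∀ Ea Er : smoothTC 𝕜 →ₗ[𝕜] smooth 𝕜, IsAdvanced Ea → IsRetarded Er →
      (∃ Φ : QuotByImage waveOp (smoothTCOdd 𝕜) ≃ₗ[𝕜]
          dirichletSolutions 𝕜 halfSpace uniqueDiffOn_halfSpace,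
        ∀ (α : smoothTCOdd 𝕜) (p : halfSpace),
          (Φ (Submodule.Quotient.mk α) : halfSpace → 𝕜) p =
            ((Ea - Er) (Submodule.inclusion smoothTCOdd_le α) : Spacetime → 𝕜) p) ∧
      ∀ (d : ℝ) (hd : 0 < d),
        ∃ Φ : QuotByImage waveOp (smoothTCSlab 𝕜 d) ≃ₗ[𝕜]
            dirichletSolutions 𝕜 (slab d) (uniqueDiffOn_slab hd),
          ∀ (α : smoothTCSlab 𝕜 d) (p : slab d),
            (Φ (Submodule.Quotient.mk α) : slab d → 𝕜) p =
              ((Ea - Er) (Submodule.inclusion (smoothTCSlab_le d) α) : Spacetime → 𝕜) p) := by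
  refine ⟨existsUnique_isAdvanced 𝕜, existsUnique_isRetarded 𝕜,
    fun φ hφ => existsUnique_extension_halfSpace hφ,
    fun d hd φ hφ => existsUnique_extension_slab hd hφ, fun Ea Er ha hr => ⟨?_, fun d hd => ?_⟩⟩
  · refine exists_causalPropagator_equiv uniqueDiffOn_halfSpace (C := {0})
      (fun p hp => mem_frontier_halfSpace.1 hp) smoothTCOdd_le (fun f => by simp [smoothTCOdd])
      (fun φ hφ => ?_) (fun f g hf hg h => ?_) (isAdvanced_iff.1 ha) (isRetarded_iff.1 hr)
    · obtain ⟨ψ, ⟨hw, hψ, h⟩, -⟩ := existsUnique_extension_halfSpace hφ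
      exact ⟨ψ, hw, by simpa using hψ, h⟩
    · exact eq_of_oddAbout_of_eqOn_halfSpace (hf 0 rfl) (hg 0 rfl) h
  · refine exists_causalPropagator_equiv (uniqueDiffOn_slab hd) (C := {0, d})
      (fun p hp => (mem_frontier_slab hd).1 hp) (smoothTCSlab_le d)
      (fun f => by simp [smoothTCSlab, smoothTCOdd, and_assoc])
      (fun φ hφ => ?_) (fun f g hf hg h => ?_) (isAdvanced_iff.1 ha) (isRetarded_iff.1 hr)
    · obtain ⟨ψ, ⟨hw, hψ, hψd, h⟩, -⟩ := existsUnique_extension_slab hd hφ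
      exact ⟨ψ, hw, by simpa using ⟨hψ, hψd⟩, h⟩
    · exact eq_of_oddAbout_of_eqOn_slab hd (hf 0 (by simp)) (hf d (by simp)) (hg 0 (by simp))
        (hg d (by simp)) h
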